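/- Let $Z=(Z_1,\dots,Z_n)$ be a vector of independent standard Gaussian random variables, and let $f=f(Z)=Z^\intercal F Z+v\cdot Z+f_0$ be a non-constant real polynomial in $Z$ of degree at most $2$, where $F\in\mathbb R^{n\times n}$ is symmetric, $v\in\mathbb R^n$ and $f_0\in\mathbb R$. Write $\mathbb E f$ and $\sigma(f)$ for the mean and the standard deviation of $f$, and $\|\cdot\|_{\mathrm F}$ for the Frobenius norm. (1) There is an absolute constant $c>0$, and for every $\eta>0$ there is a constant $C_\eta>0$ depending only on $\eta$, such that the following holds (for all $n$, $F$, $v$, $f_0$ as above). Suppose that $F\neq 0$ and $$\min_{\substack{\widetilde F\in\mathbb R^{n\times n}\\ \operatorname{rank}(\widetilde F)\le 3}}\frac{\|F-\widetilde F\|_{\mathrm F}^2}{\|F\|_{\mathrm F}^2}\ \ge\ \eta .$$ Then for all $x\in\mathbb R$ and all $0\le\varepsilon\le\sigma(f)$, $$\Pr\bigl[f-\mathbb E f\in[x,x+\varepsilon]\bigr]\ \le\ C_\eta\,\frac{\varepsilon}{\sigma(f)}\,\exp\Bigl(-c\,\frac{|x|}{\sigma(f)}\Bigr).$$ (2) For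 every $A>0$ there is a constant $c_A>0$ depending only on $A$ such that the following holds (for all $n$, $F$, $v$, $f_0$ as above). Let $\lambda_1,\dots,\lambda_n$ be the eigenvalues of $F$, listed with multiplicity in some order, and suppose that $|\lambda_i|\le\lambda_1$ for $i=1,\dots,n$. Then for all $0\le\varepsilon\le\sigma(f)$, $$\inf_{0\le x\le A\sigma(f)}\Pr\bigl[f-\mathbb E f\in[x,x+\varepsilon]\bigr]\ \ge\ c_A\,\frac{\varepsilon}{\sigma(f)} .$$ -/

import Mathlib

open MeasureTheory ProbabilityTheory
open scoped Matrix Matrix.Norms.Frobenius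

noncomputable section

/-- The polynomial `z ↦ zᵀ F z + v · z + c` of degree at most two. -/
def quadPoly {n : ℕ} (F : Matrix (Fin n) (Fin n) ℝ) (v : Fin n → ℝ) (c : ℝ)
    (z : Fin n → ℝ) : ℝ :=
  z ⬝ᵥ (F *ᵥ z) + v ⬝ᵥ z + c

/-- The standard deviation of a real random variable. -/
def stdDev {Ω : Type*} [MeasurableSpace Ω] (P : Measure Ω) (X : Ω → ℝ) : ℝ :=
  Real.sqrt (variance X P)

/-- The coordinates of the random vector `Z` are independent standard Gaussians. -/
structure IsStdGaussianVector {Ω : Type*} [MeasurableSpace Ω] (P : Measure Ω) {n : ℕ}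
    (Z : Ω → Fin n → ℝ) : Prop where
  hasLaw : ∀ i, HasLaw (fun ω => Z ω i) (gaussianReal 0 1) P
  indep : iIndepFun (fun i ω => Z ω i) P

end

/-! Diagonalize `F` orthogonally. By rotation invariance of the Gaussian measure, `f - 𝔼 f` has the
law of `g = ∑ lᵢ(wᵢ² - 1) + aᵢwᵢ` with `lᵢ` the eigenvalues, and its variance is `2∑lᵢ² + ∑aᵢ²`.
Dividing by `σ(f)` reduces everything to unit variance.

Upper bound. `𝔼 exp((θ + it)g)` is an explicit product of one-dimensional Gaussian integrals. For
`|θ| ≤ 1/8` the fourth power of its modulus is at most a constant times `∏(1 + 2t²lᵢ²)⁻¹`, times a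
factor decaying through the `aᵢ`. Distance from rank 3 means that removing any three eigenvalues
keeps a proportion `η` of `∑lᵢ²`. This bounds the fourth elementary symmetric polynomial of the
`t²lᵢ²` from below, so the modulus is `O_η(1/(1 + t²))` (`norm_integral_cexp_diagQuad_le`).
Smoothing the indicator of the interval by a Gaussian bump of width `ε` and inverting the Fourier
transform gives the factor `ε`. The tilt `θ = ±1/8`, signed like `x`, gives the exponential decay.

Lower bound. The event `g ∈ [-K, 0]` has probability bounded below, by comparing second and fourth
moments and applying Chebyshev. From such points move along a direction in which `g` rises past `x +
ε` within bounded time and with bounded speed. The path then spends time at least a constant times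
`ε` in `[x, x + ε]`. Translation changes Gaussian density by a bounded factor, so Fubini turns time
spent into probability (`sweep_le`).

The direction must not depend on the Gaussian being translated, so `w` is written as `(X + Y)/√2`
and only `Y` moves. If all eigenvalues are small, the direction is the gradient seen from `X`: its
squared length concentrates near `1/2` and curvature is negligible. Otherwise the largest eigenvalue
is bounded below, and its positive curvature makes `g` grow along that axis. The hypothesis `|λᵢ| ≤
λ₁` makes these cases exhaustive. -/

/-- The standard Gaussian measure on `ℝⁿ`. -/
noncomputable abbrev stdPi (n : ℕ) : Measure (Fin n → ℝ) :=
  Measure.pi (fun _ : Fin n => gaussianReal 0 1)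

/-- The centred diagonal quadratic form `w ↦ ∑ lᵢ (wᵢ² - 1) + aᵢ wᵢ`. -/
def diagQuad {n : ℕ} (l a w : Fin n → ℝ) : ℝ :=
  ∑ i, (l i * (w i ^ 2 - 1) + a i * w i)

/-! ### Complex exponential moments in one variable. -/

section ComplexMGF

lemma integrable_gaussianReal_iff {E : Type*} [NormedAddCommGroup E] [NormedSpace ℝ E]
    {f : ℝ → E} :
    Integrable f (gaussianReal 0 1) ↔
      Integrable (fun x => gaussianPDFReal 0 1 x • f x) := by
  rw [gaussianReal_of_var_ne_zero 0 one_ne_zero,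
    integrable_withDensity_iff_integrable_smul' (measurable_gaussianPDF _ _)
      (ae_of_all _ fun _ => gaussianPDF_lt_top)]
  simp [toReal_gaussianPDF]

lemma gaussianPDF_smul_cexp (l a : ℝ) (z : ℂ) (w : ℝ) :
    gaussianPDFReal 0 1 w • Complex.exp (z * ((l * (w ^ 2 - 1) + a * w : ℝ) : ℂ)) =
      (((√(2 * Real.pi))⁻¹ : ℝ) : ℂ) *
        Complex.exp ((z * l - 1 / 2) * w ^ 2 + (z * a) * w + (-(z * l))) := by
  rw [gaussianPDFReal_def, Complex.real_smul]
  push_cast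
  rw [mul_assoc, ← Complex.exp_add]
  simp only [mul_one]
  congr 2
  ring

lemma integrable_cexp_quad (l a : ℝ) (z : ℂ) (hz : z.re * l < 1 / 2) :
    Integrable (fun w : ℝ => Complex.exp (z * ((l * (w ^ 2 - 1) + a * w : ℝ) : ℂ)))
      (gaussianReal 0 1) := by
  rw [integrable_gaussianReal_iff]
  simp_rw [gaussianPDF_smul_cexp]
  refine (integrable_cexp_quadratic' ?_ _ _).const_mul _
  simp
  linarith

/-- Completing the square produces `(1 - 2zl)^(-1/2)` times an exponential. The fourth power of the
norm removes the complex root and leaves a rational factor. -/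
lemma norm_integral_cexp_quad (l a : ℝ) (z : ℂ) (hz : z.re * l < 1 / 2) :
    ‖∫ w : ℝ, Complex.exp (z * ((l * (w ^ 2 - 1) + a * w : ℝ) : ℂ)) ∂(gaussianReal 0 1)‖ ^ 4 =
      (Complex.normSq (1 - 2 * z * l))⁻¹ *
        Real.exp (4 * (-(z.re * l) + a ^ 2 * (z ^ 2 / (2 * (1 - 2 * z * l))).re)) := by
  have hre : (z * l - 1 / 2 : ℂ).re < 0 := by simp; linarith
  rw [integral_gaussianReal_eq_integral_smul one_ne_zero]
  simp_rw [gaussianPDF_smul_cexp]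
  rw [integral_const_mul, integral_cexp_quadratic hre, norm_mul, norm_mul, mul_pow, mul_pow]
  have hp : (1 - 2 * z * l : ℂ) ≠ 0 := by
    intro h
    have := congrArg Complex.re h
    simp at this
    linarith
  have hb : (z * l - 1 / 2 : ℂ) ≠ 0 := by
    intro h; rw [h] at hre; simp at hre
  have h1 : ‖((Real.pi : ℂ) / -(z * l - 1 / 2)) ^ (1 / 2 : ℂ)‖ ^ 4 =
      4 * Real.pi ^ 2 * (Complex.normSq (1 - 2 * z * l))⁻¹ := by
    have : (Real.pi : ℂ) / -(z * l - 1 / 2) = 2 * Real.pi / (1 - 2 * z * l) := by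
      have hb' : -(z * l - 1 / 2 : ℂ) ≠ 0 := neg_ne_zero.mpr hb
      rw [div_eq_div_iff hb' hp]; ring
    rw [this]
    have h2 : ((2 * Real.pi / (1 - 2 * z * l) : ℂ) ^ (1 / 2 : ℂ)) ^ 2 =
        2 * Real.pi / (1 - 2 * z * l) := by
      have := Complex.cpow_nat_inv_pow (2 * Real.pi / (1 - 2 * z * l) : ℂ) two_ne_zero
      rw [one_div]
      exact_mod_cast this
    rw [show (4 : ℕ) = 2 * 2 from rfl, pow_mul, ← norm_pow, h2, norm_div, div_pow,
      ← Complex.normSq_eq_norm_sq, ← Complex.normSq_eq_norm_sq (1 - 2 * z * l), div_eq_mul_inv]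
    congr 1
    simp [Complex.normSq_apply]
    ring
  have h3 : ‖(((√(2 * Real.pi))⁻¹ : ℝ) : ℂ)‖ ^ 4 = (4 * Real.pi ^ 2)⁻¹ := by
    rw [Complex.norm_real, Real.norm_eq_abs, abs_of_nonneg (by positivity), inv_pow,
      show (4 : ℕ) = 2 * 2 from rfl, pow_mul, Real.sq_sqrt (by positivity)]
    ring
  have h4 : (-(z * l) - (z * a) ^ 2 / (4 * (z * l - 1 / 2)) : ℂ) =
      -(z * l) + ((a ^ 2 : ℝ) : ℂ) * (z ^ 2 / (2 * (1 - 2 * z * l))) := by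
    push_cast
    rw [show (z * l - 1 / 2 : ℂ) = -(1 - 2 * z * l) / 2 by ring]
    field_simp
    ring
  rw [h1, h3, h4, Complex.norm_exp, ← Real.exp_nat_mul]
  have : (Real.pi) ≠ 0 := Real.pi_ne_zero
  simp only [Complex.add_re, Complex.neg_re, Complex.re_ofReal_mul, Complex.re_mul_ofReal]
  field_simp
  norm_num

end ComplexMGF

/-! ### Elementary symmetric polynomials under removal of few terms. -/

section ElementarySymmetric

variable {ι : Type*} [DecidableEq ι]

/-- Double counting of pairs `(T, i)` with `i ∉ T`: each `(k+1)`-set arises from `k + 1` of them. -/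
lemma sum_powersetCard_prod_mul_le (s : Finset ι) (x : ι → ℝ) (hx : ∀ i, 0 ≤ x i) (Y : ℝ) (k : ℕ)
    (hY : ∀ T ∈ s.powersetCard k, Y ≤ ∑ i ∈ s \ T, x i) :
    Y * ∑ T ∈ s.powersetCard k, ∏ i ∈ T, x i ≤
      (k + 1) * ∑ T ∈ s.powersetCard (k + 1), ∏ i ∈ T, x i := by
  have key : ∑ T ∈ s.powersetCard k, ∑ i ∈ s \ T, x i * ∏ j ∈ T, x j =
      ∑ T ∈ s.powersetCard (k + 1), ∑ _i ∈ T, ∏ j ∈ T, x j := by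
    rw [Finset.sum_sigma', Finset.sum_sigma']
    refine Finset.sum_bij' (fun p _ => ⟨insert p.2 p.1, p.2⟩) (fun p _ => ⟨p.1.erase p.2, p.2⟩)
      ?_ ?_ ?_ ?_ ?_
    · rintro ⟨T, i⟩ h
      simp only [Finset.mem_sigma, Finset.mem_powersetCard, Finset.mem_sdiff] at h ⊢
      refine ⟨⟨Finset.insert_subset h.2.1 h.1.1, ?_⟩, Finset.mem_insert_self _ _⟩
      rw [Finset.card_insert_of_notMem h.2.2, h.1.2]
    · rintro ⟨T, i⟩ h
      simp only [Finset.mem_sigma, Finset.mem_powersetCard, Finset.mem_sdiff] at h ⊢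
      refine ⟨⟨(Finset.erase_subset _ _).trans h.1.1, ?_⟩, h.1.1 h.2, Finset.notMem_erase _ _⟩
      rw [Finset.card_erase_of_mem h.2, h.1.2]; rfl
    · rintro ⟨T, i⟩ h
      simp only [Finset.mem_sigma, Finset.mem_powersetCard, Finset.mem_sdiff] at h
      simp [Finset.erase_insert h.2.2]
    · rintro ⟨T, i⟩ h
      simp only [Finset.mem_sigma, Finset.mem_powersetCard] at h
      simp [Finset.insert_erase h.2]
    · rintro ⟨T, i⟩ h
      simp only [Finset.mem_sigma, Finset.mem_powersetCard, Finset.mem_sdiff] at h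
      simp [Finset.prod_insert h.2.2]
  have h2 : ∑ T ∈ s.powersetCard (k + 1), ∑ _i ∈ T, ∏ j ∈ T, x j =
      (k + 1) * ∑ T ∈ s.powersetCard (k + 1), ∏ i ∈ T, x i := by
    rw [Finset.mul_sum]
    refine Finset.sum_congr rfl fun T hT => ?_
    rw [Finset.sum_const, (Finset.mem_powersetCard.1 hT).2, nsmul_eq_mul]
    push_cast; rfl
  rw [← h2, ← key, Finset.mul_sum]
  refine Finset.sum_le_sum fun T hT => ?_
  rw [← Finset.sum_mul]
  exact mul_le_mul_of_nonneg_right (hY T hT) (Finset.prod_nonneg fun i _ => hx i)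

/-- Four steps of the recursion give `e₄ ≥ Y⁴/4!`, and expanding the product leaves at least `e₀ +
e₄`. -/
lemma one_add_pow_four_le_prod (s : Finset ι) (x : ι → ℝ) (hx : ∀ i, 0 ≤ x i) (Y : ℝ)
    (hY0 : 0 ≤ Y) (hY : ∀ T ⊆ s, T.card ≤ 3 → Y ≤ ∑ i ∈ s \ T, x i) :
    1 + Y ^ 4 / 24 ≤ ∏ i ∈ s, (1 + x i) := by
  set e : ℕ → ℝ := fun k => ∑ T ∈ s.powersetCard k, ∏ i ∈ T, x i with he
  have step : ∀ k ≤ 3, Y * e k ≤ (k + 1) * e (k + 1) := fun k hk =>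
    sum_powersetCard_prod_mul_le s x hx Y k fun T hT => by
      rw [Finset.mem_powersetCard] at hT
      exact hY T hT.1 (hT.2.trans_le hk)
  have e0 : e 0 = 1 := by simp [he]
  have h0 := step 0 (by norm_num)
  have h1 := step 1 (by norm_num)
  have h2 := step 2 (by norm_num)
  have h3 := step 3 (by norm_num)
  norm_num at h0 h1 h2 h3
  rw [e0] at h0
  have h4 : Y ^ 4 / 24 ≤ e 4 := by
    have a1 := mul_le_mul_of_nonneg_left h0 hY0
    have a2 := mul_le_mul_of_nonneg_left (a1.trans h1) hY0
    have a3 := mul_le_mul_of_nonneg_left h2 hY0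
    have a4 := mul_le_mul_of_nonneg_left a2 hY0
    nlinarith
  rw [Finset.prod_one_add]
  have hsub : ({∅} ∪ s.powersetCard 4 : Finset (Finset ι)) ⊆ s.powerset := by
    refine Finset.union_subset (by simp) fun T hT => ?_
    exact Finset.mem_powerset.2 (Finset.mem_powersetCard.1 hT).1
  refine le_trans ?_ (Finset.sum_le_sum_of_subset_of_nonneg hsub
    fun T _ _ => Finset.prod_nonneg fun i _ => hx i)
  rw [Finset.sum_union]
  · simp only [Finset.sum_singleton, Finset.prod_empty]
    linarith
  · rw [Finset.disjoint_singleton_left, Finset.mem_powersetCard]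
    simp

end ElementarySymmetric

/-! ### Decay of the tilted characteristic function. -/

section MGFBound

/-- Used with `y = 2θl`: it trades `(1 - 2θl)⁻²` for `exp(4θl + 8(θl)²)`, whose linear term cancels
against the centring of `w²`. Only terms quadratic in `θ` survive, and these sum to a constant. -/
lemma exp_neg_sub_sq_le_one_sub (y : ℝ) (hy : |y| ≤ 1 / 4) : Real.exp (-y - y ^ 2) ≤ 1 - y := by
  obtain ⟨h1, h2⟩ := abs_le.1 hy
  have hpos : 0 < 1 - y := by linarith
  rw [show -y - y ^ 2 = -(y + y ^ 2) by ring, Real.exp_neg, inv_le_comm₀ (Real.exp_pos _) hpos,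
    inv_eq_one_div, div_le_iff₀ hpos]
  rcases le_total 0 y with h | h
  · have := Real.quadratic_le_exp_of_nonneg (x := y + y ^ 2) (by positivity)
    have h3 : 1 ≤ (1 + (y + y ^ 2) + (y + y ^ 2) ^ 2 / 2) * (1 - y) := by
      nlinarith [mul_nonneg h h, mul_nonneg (mul_nonneg h h) h,
        mul_nonneg (mul_nonneg h h) (by linarith : 0 ≤ 1/4 - y),
        mul_nonneg (mul_nonneg (mul_nonneg h h) h) (by linarith : 0 ≤ 1/4 - y)]
    nlinarith
  · have := Real.add_one_le_exp (y + y ^ 2)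
    have h3 : 1 ≤ (y + y ^ 2 + 1) * (1 - y) := by
      nlinarith [mul_nonneg (mul_self_nonneg y) (neg_nonneg.2 h)]
    nlinarith

/-- Since `(1 - 2θl)² ≤ 2`, the factor `(1 - 2θl)² + 4t²l²` splits into a tilt part and a `t` part.
Replacing `l²` by a common `Λ` in the exponent lets the contributions of the `aᵢ` be added over
coordinates. -/
lemma norm_integral_cexp_quad_le (l a θ t Λ : ℝ) (hs : |θ * l| ≤ 1 / 8) (hΛ : l ^ 2 ≤ Λ) :
    ‖∫ w : ℝ, Complex.exp ((θ + t * Complex.I : ℂ) * ((l * (w ^ 2 - 1) + a * w : ℝ) : ℂ))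
        ∂(gaussianReal 0 1)‖ ^ 4 ≤
      (1 + 2 * t ^ 2 * l ^ 2)⁻¹ * Real.exp (8 * (θ * l) ^ 2 + 3 * (θ * a) ^ 2 -
        24 / 25 * (a ^ 2 * (t ^ 2 / (1 + 4 * t ^ 2 * Λ)))) := by
  obtain ⟨hs1, hs2⟩ := abs_le.1 hs
  rw [norm_integral_cexp_quad l a _ (by simp; linarith)]
  set s := θ * l with hsdef
  set D : ℝ := (1 - 2 * s) ^ 2 + 4 * t ^ 2 * l ^ 2 with hD
  have hDpos : 0 < D := by
    have : 0 < (1 - 2 * s) ^ 2 := by apply pow_pos; linarith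
    positivity
  have hns : Complex.normSq (1 - 2 * (θ + t * Complex.I) * l) = D := by
    simp [Complex.normSq_apply, hD, hsdef]; ring
  have hre : ((θ + t * Complex.I : ℂ) ^ 2 / (2 * (1 - 2 * (θ + t * Complex.I) * l))).re =
      (θ ^ 2 * (1 - 2 * s) - t ^ 2 * (1 + 2 * s)) / (2 * D) := by
    rw [Complex.div_re]
    have : Complex.normSq (2 * (1 - 2 * (θ + t * Complex.I) * l)) = 4 * D := by
      rw [Complex.normSq_mul, hns]; norm_num [Complex.normSq_apply]
    rw [this]
    simp [pow_two, hsdef]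
    field_simp
    ring
  rw [hns, hre]
  have hDge : (1 - 2 * s) ^ 2 * (1 + 2 * t ^ 2 * l ^ 2) ≤ D := by
    have : (1 - 2 * s) ^ 2 ≤ 2 := by nlinarith
    have := mul_le_mul_of_nonneg_right this (by positivity : 0 ≤ 2 * t ^ 2 * l ^ 2)
    rw [hD]; nlinarith
  have h1 : D⁻¹ ≤ (1 + 2 * t ^ 2 * l ^ 2)⁻¹ * Real.exp (4 * s + 8 * s ^ 2) := by
    have hb := exp_neg_sub_sq_le_one_sub (2 * s) (by rw [abs_mul]; norm_num; linarith)
    have hb2 : Real.exp (-(4 * s + 8 * s ^ 2)) ≤ (1 - 2 * s) ^ 2 := by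
      have e : -(4 * s + 8 * s ^ 2) = ((2 : ℕ) : ℝ) * (-(2 * s) - (2 * s) ^ 2) := by
        push_cast; ring
      rw [e, Real.exp_nat_mul]
      exact pow_le_pow_left₀ (Real.exp_pos _).le hb 2
    rw [Real.exp_neg] at hb2
    have h3 : (Real.exp (4 * s + 8 * s ^ 2))⁻¹ * (1 + 2 * t ^ 2 * l ^ 2) ≤ D :=
      (mul_le_mul_of_nonneg_right hb2 (by positivity)).trans hDge
    calc D⁻¹ ≤ ((Real.exp (4 * s + 8 * s ^ 2))⁻¹ * (1 + 2 * t ^ 2 * l ^ 2))⁻¹ :=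
          inv_anti₀ (by positivity) h3
      _ = _ := by rw [mul_inv, inv_inv, mul_comm]
  have h2 : (θ ^ 2 * (1 - 2 * s) - t ^ 2 * (1 + 2 * s)) / (2 * D) ≤
      3 / 4 * θ ^ 2 - 6 / 25 * (t ^ 2 / (1 + 4 * t ^ 2 * Λ)) := by
    rw [sub_div]
    have hΛ0 : 0 ≤ Λ := (sq_nonneg l).trans hΛ
    apply sub_le_sub
    · rw [div_le_iff₀ (by positivity)]
      have : (1 - 2 * s) * (1 - 2 * s) ≤ D := by
        rw [hD]; nlinarith [mul_nonneg (sq_nonneg t) (sq_nonneg l)]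
      have h4 : (1 - 2 * s) ≤ 3 / 2 * D := by nlinarith
      nlinarith [sq_nonneg θ]
    · rw [mul_div_assoc', div_le_div_iff₀ (by positivity) (by positivity)]
      have hD2 : D ≤ 25 / 16 * (1 + 4 * t ^ 2 * Λ) := by
        have : (1 - 2 * s) ^ 2 ≤ 25 / 16 := by nlinarith
        have := mul_le_mul_of_nonneg_left hΛ (sq_nonneg t)
        have : 0 ≤ t ^ 2 * Λ := by positivity
        rw [hD]; nlinarith
      have h5 : 6 / 25 * (2 * D) ≤ (1 + 2 * s) * (1 + 4 * t ^ 2 * Λ) := by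
        have : 0 ≤ 1 + 4 * t ^ 2 * Λ := by positivity
        nlinarith
      nlinarith [sq_nonneg t]
  have hre' : (θ + t * Complex.I : ℂ).re * l = s := by simp [hsdef]
  rw [hre']
  calc D⁻¹ * _ ≤ ((1 + 2 * t ^ 2 * l ^ 2)⁻¹ * Real.exp (4 * s + 8 * s ^ 2)) *
        Real.exp (4 * (-s + a ^ 2 * (3 / 4 * θ ^ 2 - 6 / 25 * (t ^ 2 / (1 + 4 * t ^ 2 * Λ))))) := by
        gcongr
    _ = _ := by
        rw [mul_assoc, ← Real.exp_add]
        congr 2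
        ring

lemma integrable_cexp_diagQuad {n : ℕ} (l a : Fin n → ℝ) (z : ℂ) (hz : ∀ i, z.re * l i < 1 / 2) :
    Integrable (fun w => Complex.exp (z * (diagQuad l a w : ℝ))) (stdPi n) := by
  have : (fun w => Complex.exp (z * (diagQuad l a w : ℝ))) = fun w : Fin n → ℝ =>
      ∏ i, Complex.exp (z * ((l i * (w i ^ 2 - 1) + a i * w i : ℝ) : ℂ)) := by
    ext w
    rw [← Complex.exp_sum, ← Finset.mul_sum, diagQuad, Complex.ofReal_sum]
  rw [this]
  exact Integrable.fintype_prod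
    (f := fun i w => Complex.exp (z * ((l i * (w ^ 2 - 1) + a i * w : ℝ) : ℂ)))
    fun i => integrable_cexp_quad _ _ _ (hz i)

lemma integral_cexp_diagQuad {n : ℕ} (l a : Fin n → ℝ) (z : ℂ) :
    ∫ w, Complex.exp (z * (diagQuad l a w : ℝ)) ∂(stdPi n) =
      ∏ i, ∫ w : ℝ, Complex.exp (z * ((l i * (w ^ 2 - 1) + a i * w : ℝ) : ℂ))
        ∂(gaussianReal 0 1) := by
  rw [← integral_fintype_prod_eq_prod
    (f := fun i w => Complex.exp (z * ((l i * (w ^ 2 - 1) + a i * w : ℝ) : ℂ)))]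
  congr with w
  rw [← Complex.exp_sum, ← Finset.mul_sum, diagQuad, Complex.ofReal_sum]

lemma norm_integral_cexp_diagQuad_pow_le {n : ℕ} (l a : Fin n → ℝ) (θ t : ℝ)
    (hvar : 2 * ∑ i, l i ^ 2 + ∑ i, a i ^ 2 = 1) (hθ : |θ| ≤ 1 / 8) :
    ‖∫ w, Complex.exp ((θ + t * Complex.I : ℂ) * (diagQuad l a w : ℝ)) ∂(stdPi n)‖ ^ 4 ≤
      2 * ((∏ i, (1 + 2 * t ^ 2 * l i ^ 2))⁻¹ *
        Real.exp (-(24 / 25 * ((∑ i, a i ^ 2) * (t ^ 2 / (1 + 4 * t ^ 2 * ∑ i, l i ^ 2)))))) := by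
  have hB : 0 ≤ ∑ i, a i ^ 2 := Finset.sum_nonneg fun i _ => sq_nonneg _
  have hli : ∀ i, l i ^ 2 ≤ ∑ i, l i ^ 2 := fun i =>
    Finset.single_le_sum (f := fun i => l i ^ 2) (fun i _ => sq_nonneg _) (Finset.mem_univ i)
  have hl1 : ∀ i, |l i| ≤ 1 := fun i => by
    rw [← sq_le_one_iff_abs_le_one]
    have := hli i
    linarith [sq_nonneg (l i)]
  have hθl : ∀ i, |θ * l i| ≤ 1 / 8 := fun i => by
    rw [abs_mul]
    nlinarith [abs_nonneg θ, abs_nonneg (l i), hl1 i]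
  rw [integral_cexp_diagQuad, norm_prod, ← Finset.prod_pow]
  refine (Finset.prod_le_prod (fun i _ => by positivity) fun i _ =>
    norm_integral_cexp_quad_le (l i) (a i) θ t _ (hθl i) (hli i)).trans ?_
  rw [Finset.prod_mul_distrib, Finset.prod_inv_distrib, ← Real.exp_sum]
  have hsum : ∑ i, (8 * (θ * l i) ^ 2 + 3 * (θ * a i) ^ 2 -
        24 / 25 * (a i ^ 2 * (t ^ 2 / (1 + 4 * t ^ 2 * ∑ i, l i ^ 2)))) =
      (8 * θ ^ 2 * ∑ i, l i ^ 2 + 3 * θ ^ 2 * ∑ i, a i ^ 2) +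
      -(24 / 25 * ((∑ i, a i ^ 2) * (t ^ 2 / (1 + 4 * t ^ 2 * ∑ i, l i ^ 2)))) := by
    rw [Finset.sum_sub_distrib, Finset.sum_add_distrib, ← sub_eq_add_neg, Finset.sum_mul]
    simp only [mul_pow, Finset.mul_sum, mul_assoc]
  rw [hsum, Real.exp_add]
  have hθ2 : θ ^ 2 ≤ 1 / 64 := by
    obtain ⟨h1, h2⟩ := abs_le.1 hθ
    nlinarith
  have hc : Real.exp (8 * θ ^ 2 * ∑ i, l i ^ 2 + 3 * θ ^ 2 * ∑ i, a i ^ 2) ≤ 2 := by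
    have h1 : 8 * θ ^ 2 * ∑ i, l i ^ 2 + 3 * θ ^ 2 * ∑ i, a i ^ 2 ≤ 1 / 16 := by
      have e : 2 * ∑ i, l i ^ 2 = 1 - ∑ i, a i ^ 2 := by linarith
      have : 8 * θ ^ 2 * ∑ i, l i ^ 2 + 3 * θ ^ 2 * ∑ i, a i ^ 2 =
        4 * θ ^ 2 - θ ^ 2 * ∑ i, a i ^ 2 := by
        rw [show 8 * θ ^ 2 * ∑ i, l i ^ 2 = 4 * θ ^ 2 * (2 * ∑ i, l i ^ 2) by ring, e]; ring
      have := mul_nonneg (sq_nonneg θ) hB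
      linarith
    have h3 : Real.exp (1 / 16) ≤ 2 := by
      have := Real.exp_bound_div_one_sub_of_interval (x := 1 / 16) (by norm_num) (by norm_num)
      linarith
    exact (Real.exp_le_exp.2 h1).trans h3
  rw [mul_left_comm]
  gcongr

/-- With `v = 4t²Λ` and `y = Bt²/(1 + v)`, the eigenvalues contribute `(1 + v)⁻⁴` and the linear
terms `(1 + 6y/25)⁻⁴`. The identity `(1 + v)(1 + 6y/25) = 1 + v + 6Bt²/25` shows that one of them
decays whichever of `Λ`, `B` carries the variance. -/
lemma norm_integral_cexp_diagQuad_le {n : ℕ} (l a : Fin n → ℝ) (θ t η : ℝ) (hη : 0 < η)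
    (hvar : 2 * ∑ i, l i ^ 2 + ∑ i, a i ^ 2 = 1) (hθ : |θ| ≤ 1 / 8)
    (hrank : ∀ T : Finset (Fin n), T.card ≤ 3 → η * ∑ i, l i ^ 2 ≤ ∑ i ∈ Tᶜ, l i ^ 2) :
    ‖∫ w, Complex.exp ((θ + t * Complex.I : ℂ) * (diagQuad l a w : ℝ)) ∂(stdPi n)‖ ≤
      (16 * (1 + 384 / η ^ 4)) * (1 + (t / 3) ^ 2)⁻¹ := by
  have hmain := norm_integral_cexp_diagQuad_pow_le l a θ t hvar hθ
  set Λ := ∑ i, l i ^ 2 with hΛ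
  set B := ∑ i, a i ^ 2 with hB
  have hΛ0 : 0 ≤ Λ := Finset.sum_nonneg fun i _ => sq_nonneg _
  have hB0 : 0 ≤ B := Finset.sum_nonneg fun i _ => sq_nonneg _
  set v := 4 * t ^ 2 * Λ with hv
  have hv0 : 0 ≤ v := by positivity
  have hprod : 1 + (η * v / 2) ^ 4 / 24 ≤ ∏ i, (1 + 2 * t ^ 2 * l i ^ 2) := by
    refine one_add_pow_four_le_prod Finset.univ (fun i => 2 * t ^ 2 * l i ^ 2)
      (fun i => by positivity) _ (by positivity) fun T _ hT => ?_
    rw [← Finset.mul_sum, ← Finset.compl_eq_univ_sdiff]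
    have := mul_le_mul_of_nonneg_left (hrank T hT) (by positivity : 0 ≤ 2 * t ^ 2)
    rw [hv]; linarith
  -- `384 = 24 · 2⁴` undoes `(ηv/2)⁴/24`, and `8` comes from `(1 + v)⁴ ≤ 8(1 + v⁴)`.
  set K := 8 * (1 + 384 / η ^ 4) with hK
  have hK1 : 1 ≤ K := by
    have : 0 ≤ 384 / η ^ 4 := by positivity
    rw [hK]; linarith
  have h1 : (1 + v) ^ 4 ≤ K * ∏ i, (1 + 2 * t ^ 2 * l i ^ 2) := by
    have e1 : (1 + v) ^ 4 ≤ 8 * (1 + v ^ 4) := by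
      nlinarith [sq_nonneg (1 - v), sq_nonneg (1 + v), sq_nonneg (1 - v ^ 2),
        mul_nonneg (sq_nonneg (1 - v)) (sq_nonneg (1 + v)), mul_nonneg (sq_nonneg (1 - v)) hv0]
    have e2 : 1 + v ^ 4 ≤ (1 + 384 / η ^ 4) * (1 + (η * v / 2) ^ 4 / 24) := by
      have : (1 + 384 / η ^ 4) * (1 + (η * v / 2) ^ 4 / 24) =
        1 + v ^ 4 + 384 / η ^ 4 + (η * v / 2) ^ 4 / 24 := by
        field_simp
        ring
      rw [this]
      have : 0 ≤ 384 / η ^ 4 := by positivity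
      have : 0 ≤ (η * v / 2) ^ 4 / 24 := by positivity
      linarith
    calc _ ≤ 8 * (1 + v ^ 4) := e1
      _ ≤ 8 * ((1 + 384 / η ^ 4) * (1 + (η * v / 2) ^ 4 / 24)) := by gcongr
      _ = K * (1 + (η * v / 2) ^ 4 / 24) := by rw [hK]; ring
      _ ≤ _ := by gcongr
  set y := B * (t ^ 2 / (1 + v)) with hy
  have hy0 : 0 ≤ y := by positivity
  have h2 : Real.exp (-(24 / 25 * y)) ≤ ((1 + 6 / 25 * y) ^ 4)⁻¹ := by
    rw [Real.exp_neg]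
    apply inv_anti₀ (by positivity)
    have := pow_le_pow_left₀ (by positivity) (Real.add_one_le_exp (6 / 25 * y)) 4
    rw [← Real.exp_nat_mul] at this
    convert this using 2
    · ring
    · push_cast; ring
  have h3 : (∏ i, (1 + 2 * t ^ 2 * l i ^ 2))⁻¹ ≤ K * ((1 + v) ^ 4)⁻¹ := by
    have hp : 0 < ∏ i, (1 + 2 * t ^ 2 * l i ^ 2) := Finset.prod_pos fun i _ => by positivity
    rw [← div_eq_mul_inv, le_div_iff₀ (by positivity), inv_mul_le_iff₀ hp, mul_comm]
    exact h1
  have h4 : 1 + (t / 3) ^ 2 ≤ (1 + v) * (1 + 6 / 25 * y) := by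
    have : (1 + v) * (1 + 6 / 25 * y) = 1 + v + 6 / 25 * (B * t ^ 2) := by
      rw [hy]; field_simp
    rw [this, hv]
    have : t ^ 2 = t ^ 2 * (2 * Λ + B) := by rw [hvar, mul_one]
    have : 0 ≤ t ^ 2 * Λ := by positivity
    have : 0 ≤ t ^ 2 * B := by positivity
    nlinarith
  have h5 : ‖∫ w, Complex.exp ((θ + t * Complex.I : ℂ) * (diagQuad l a w : ℝ)) ∂(stdPi n)‖ ^ 4 ≤
      ((16 * (1 + 384 / η ^ 4)) * (1 + (t / 3) ^ 2)⁻¹) ^ 4 := by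
    calc _ ≤ _ := hmain
      _ ≤ 2 * ((K * ((1 + v) ^ 4)⁻¹) * ((1 + 6 / 25 * y) ^ 4)⁻¹) := by gcongr
      _ = (2 * K) * (((1 + v) * (1 + 6 / 25 * y))⁻¹) ^ 4 := by
          rw [mul_inv, mul_pow, inv_pow, inv_pow]; ring
      _ ≤ (2 * K) ^ 4 * ((1 + (t / 3) ^ 2)⁻¹) ^ 4 := by
          gcongr
          exact le_self_pow₀ (by linarith) (by norm_num)
      _ = _ := by rw [← mul_pow, hK]; ring
  exact le_of_pow_le_pow_left₀ (by norm_num) (by positivity) h5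

end MGFBound

/-! ### Fourier inversion and the upper bound. -/

section UpperBound

lemma measurable_diagQuad {n : ℕ} (l a : Fin n → ℝ) : Measurable (diagQuad l a) := by
  unfold diagQuad; fun_prop

lemma integrable_exp_diagQuad {n : ℕ} (l a : Fin n → ℝ) (θ : ℝ) (hθ : ∀ i, θ * l i < 1 / 2) :
    Integrable (fun w => Real.exp (θ * diagQuad l a w)) (stdPi n) := by
  have := (integrable_cexp_diagQuad l a (θ : ℂ) (by simpa using hθ)).norm
  simpa [Complex.norm_exp] using this

lemma gaussianPDFReal_zero_one_le_one (x : ℝ) : gaussianPDFReal 0 1 x ≤ 1 := by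
  rw [gaussianPDFReal_def]
  have h1 : (√(2 * Real.pi * (1 : NNReal)))⁻¹ ≤ 1 := by
    apply inv_le_one_of_one_le₀
    rw [Real.one_le_sqrt]
    have := Real.pi_gt_three
    simp; linarith
  have h2 : Real.exp (-(x - 0) ^ 2 / (2 * (1 : NNReal))) ≤ 1 := by
    rw [Real.exp_le_one_iff]
    have := sq_nonneg (x - 0)
    simp
    nlinarith
  exact mul_le_one₀ h1 (Real.exp_pos _).le h2

lemma integral_inv_one_add_sq_gaussianReal_le (c : ℝ) (hc : 0 < c) :
    ∫ N, (1 + (N / c) ^ 2)⁻¹ ∂(gaussianReal 0 1) ≤ Real.pi * c := by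
  rw [integral_gaussianReal_eq_integral_smul one_ne_zero]
  have hint : Integrable (fun N : ℝ => (1 + (N / c) ^ 2)⁻¹) :=
    integrable_inv_one_add_sq.comp_div hc.ne'
  calc _ ≤ ∫ N : ℝ, (1 + (N / c) ^ 2)⁻¹ := by
        refine integral_mono_of_nonneg (ae_of_all _ fun N => ?_) hint (ae_of_all _ fun N => ?_)
        · exact mul_nonneg (gaussianPDFReal_nonneg _ _ _) (by positivity)
        · exact mul_le_of_le_one_left (by positivity) (gaussianPDFReal_zero_one_le_one N)
    _ = Real.pi * c := by
        rw [Measure.integral_comp_div (fun N : ℝ => (1 + N ^ 2)⁻¹) c,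
          integral_univ_inv_one_add_sq, abs_of_pos hc, smul_eq_mul, mul_comm]

/-- The bump `exp(-y²/2)` is the characteristic function of a standard Gaussian `N`, so Fubini
leaves the moment at `θ + iN/ε`, up to a phase. The density of `N` is at most 1, and integrating `(1
+ (N/3ε)²)⁻¹` over the line yields the factor `ε`. -/
lemma integral_exp_mul_gaussian_le {n : ℕ} (l a : Fin n → ℝ) (θ M x ε : ℝ) (hε : 0 < ε)
    (hM : 0 ≤ M) (hθ : ∀ i, θ * l i < 1 / 2)
    (hbound : ∀ t : ℝ, ‖∫ w, Complex.exp ((θ + t * Complex.I : ℂ) * (diagQuad l a w : ℝ))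
      ∂(stdPi n)‖ ≤ M * (1 + (t / 3) ^ 2)⁻¹) :
    ∫ w, Real.exp (θ * diagQuad l a w) * Real.exp (-((diagQuad l a w - x) / ε) ^ 2 / 2)
      ∂(stdPi n) ≤ M * (Real.pi * (3 * ε)) := by
  set g := diagQuad l a with hg
  have hgm : Measurable g := measurable_diagQuad l a
  set k : (Fin n → ℝ) → ℝ → ℂ := fun w N =>
    Complex.exp (θ * g w) * Complex.exp (((g w - x) / ε : ℝ) * N * Complex.I) with hk
  have hknorm : ∀ w N, ‖k w N‖ = Real.exp (θ * g w) := fun w N => by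
    rw [hk]
    simp only [norm_mul]
    rw [show (((g w - x) / ε : ℝ) * N * Complex.I : ℂ) =
      (((g w - x) / ε * N : ℝ) : ℂ) * Complex.I by push_cast; ring,
      Complex.norm_exp_ofReal_mul_I, mul_one, ← Complex.ofReal_mul, ← Complex.ofReal_exp,
      Complex.norm_real, Real.norm_eq_abs, Real.abs_exp]
  have hint : Integrable (Function.uncurry k) ((stdPi n).prod (gaussianReal 0 1)) := by
    refine ((integrable_exp_diagQuad l a θ hθ).comp_fst (gaussianReal 0 1)).mono' ?_
      (ae_of_all _ fun p => (hknorm p.1 p.2).le)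
    apply Measurable.aestronglyMeasurable
    simp only [hk, Function.uncurry_def]
    fun_prop
  have h1 : ((∫ w, Real.exp (θ * g w) * Real.exp (-((g w - x) / ε) ^ 2 / 2) ∂(stdPi n) : ℝ) : ℂ) =
      ∫ N, ∫ w, k w N ∂(stdPi n) ∂(gaussianReal 0 1) := by
    rw [← integral_integral_swap hint, ← integral_complex_ofReal]
    congr with w
    simp only [hk]
    rw [integral_const_mul, ← charFun_apply_real, charFun_gaussianReal]
    push_cast
    congr 2
    simp
    ring
  have h2 : ∀ N : ℝ, ‖∫ w, k w N ∂(stdPi n)‖ ≤ M * (1 + (N / (3 * ε)) ^ 2)⁻¹ := fun N => by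
    have : ∀ w, k w N = Complex.exp (((-(x / ε * N) : ℝ) : ℂ) * Complex.I) *
        Complex.exp ((θ + (N / ε : ℝ) * Complex.I : ℂ) * (g w : ℝ)) := fun w => by
      rw [hk]
      simp only
      rw [← Complex.exp_add, ← Complex.exp_add]
      congr 1
      push_cast
      field_simp
      ring
    simp_rw [this]
    rw [integral_const_mul, norm_mul, Complex.norm_exp_ofReal_mul_I, one_mul]
    have := hbound (N / ε)
    rwa [div_div, mul_comm ε 3] at this
  have hnn : 0 ≤ ∫ w, Real.exp (θ * g w) * Real.exp (-((g w - x) / ε) ^ 2 / 2) ∂(stdPi n) :=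
    integral_nonneg fun w => by positivity
  have h3 : ∫ w, Real.exp (θ * g w) * Real.exp (-((g w - x) / ε) ^ 2 / 2) ∂(stdPi n) =
      ‖∫ N, ∫ w, k w N ∂(stdPi n) ∂(gaussianReal 0 1)‖ := by
    rw [← h1, Complex.norm_real, Real.norm_of_nonneg hnn]
  rw [h3]
  calc _ ≤ ∫ N, ‖∫ w, k w N ∂(stdPi n)‖ ∂(gaussianReal 0 1) := norm_integral_le_integral_norm _
    _ ≤ ∫ N, M * (1 + (N / (3 * ε)) ^ 2)⁻¹ ∂(gaussianReal 0 1) := by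
        refine integral_mono_of_nonneg (ae_of_all _ fun N => norm_nonneg _) ?_
          (ae_of_all _ h2)
        refine (Integrable.mono' (integrable_const (1 : ℝ)) ?_ (ae_of_all _ fun N => ?_)).const_mul M
        · apply Measurable.aestronglyMeasurable
          fun_prop
        · rw [Real.norm_of_nonneg (by positivity)]
          exact inv_le_one_of_one_le₀ (by linarith [sq_nonneg (N / (3 * ε))])
    _ ≤ _ := by
        rw [integral_const_mul]
        exact mul_le_mul_of_nonneg_left
          (integral_inv_one_add_sq_gaussianReal_le _ (by positivity)) hM

theorem diagQuad_smallBall_le (η : ℝ) (hη : 0 < η) : ∃ C : ℝ, 0 < C ∧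
    ∀ (n : ℕ) (l a : Fin n → ℝ), 2 * ∑ i, l i ^ 2 + ∑ i, a i ^ 2 = 1 →
      (∀ T : Finset (Fin n), T.card ≤ 3 → η * ∑ i, l i ^ 2 ≤ ∑ i ∈ Tᶜ, l i ^ 2) →
      ∀ x ε : ℝ, 0 ≤ ε → ε ≤ 1 →
        (stdPi n).real {w | diagQuad l a w ∈ Set.Icc x (x + ε)} ≤
          C * ε * Real.exp (-(1 / 8 * |x|)) := by
  set M := 16 * (1 + 384 / η ^ 4) with hM
  refine ⟨Real.exp 1 * (M * (Real.pi * 3)), by positivity, fun n l a hvar hrank => ?_⟩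
  have hM0 : 0 ≤ M := by positivity
  have hpos : ∀ x ε : ℝ, 0 < ε → ε ≤ 1 →
        (stdPi n).real {w | diagQuad l a w ∈ Set.Icc x (x + ε)} ≤
          Real.exp 1 * (M * (Real.pi * 3)) * ε * Real.exp (-(1 / 8 * |x|)) := by
    intro x ε hε hε1
    obtain ⟨θ, hθ, hθx⟩ : ∃ θ : ℝ, |θ| = 1 / 8 ∧ θ * x = 1 / 8 * |x| := by
      rcases le_total 0 x with h | h
      · exact ⟨1 / 8, by norm_num, by rw [abs_of_nonneg h]⟩
      · exact ⟨-(1 / 8), by norm_num, by rw [abs_of_nonpos h]; ring⟩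
    have hθl : ∀ i, θ * l i < 1 / 2 := fun i => by
      have h1 : l i ^ 2 ≤ ∑ i, l i ^ 2 :=
        Finset.single_le_sum (f := fun i => l i ^ 2) (fun i _ => sq_nonneg _) (Finset.mem_univ i)
      have h2 : 0 ≤ ∑ i, a i ^ 2 := Finset.sum_nonneg fun i _ => sq_nonneg _
      have h3 : |l i| ≤ 1 := by
        rw [← sq_le_one_iff_abs_le_one]
        linarith [sq_nonneg (l i)]
      calc θ * l i ≤ |θ * l i| := le_abs_self _
        _ = |θ| * |l i| := abs_mul _ _
        _ < 1 / 2 := by rw [hθ]; linarith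
    have hmain := integral_exp_mul_gaussian_le l a θ M x ε hε hM0 hθl fun t =>
      norm_integral_cexp_diagQuad_le l a θ t η hη hvar hθ.le hrank
    have hgm := measurable_diagQuad l a
    have hms : MeasurableSet {w | diagQuad l a w ∈ Set.Icc x (x + ε)} := hgm measurableSet_Icc
    have hint : Integrable (fun w => Real.exp (θ * diagQuad l a w) *
        Real.exp (-((diagQuad l a w - x) / ε) ^ 2 / 2)) (stdPi n) := by
      refine (integrable_exp_diagQuad l a θ hθl).mono' ?_ (ae_of_all _ fun w => ?_)
      · apply Measurable.aestronglyMeasurable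
        fun_prop
      · rw [Real.norm_of_nonneg (by positivity)]
        refine mul_le_of_le_one_right (Real.exp_pos _).le (Real.exp_le_one_iff.2 ?_)
        have := sq_nonneg ((diagQuad l a w - x) / ε)
        linarith
    rw [← integral_indicator_one hms]
    -- On the interval the exponent `1 - θx + θg - ((g - x)/ε)²/2` is at least `1 - 1/8 - 1/2 > 0`,
    -- so the integrand dominates the indicator.
    calc _ ≤ ∫ w, (Real.exp 1 * Real.exp (-(1 / 8 * |x|))) * (Real.exp (θ * diagQuad l a w) *
          Real.exp (-((diagQuad l a w - x) / ε) ^ 2 / 2)) ∂(stdPi n) := by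
          refine integral_mono_of_nonneg (ae_of_all _ fun w => ?_) (hint.const_mul _)
            (ae_of_all _ fun w => ?_)
          · exact Set.indicator_nonneg (fun _ _ => zero_le_one) _
          · refine Set.indicator_apply_le' (fun hw => ?_) (fun _ => by positivity)
            beta_reduce
            rw [Pi.one_apply, ← Real.exp_add, ← Real.exp_add, ← Real.exp_add, Real.one_le_exp_iff,
              ← hθx]
            obtain ⟨h1, h2⟩ := hw
            have h3 : |θ * (diagQuad l a w - x)| ≤ 1 / 8 := by
              rw [abs_mul, hθ, abs_of_nonneg (by linarith)]
              linarith
            have h4 : ((diagQuad l a w - x) / ε) ^ 2 ≤ 1 := by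
              apply pow_le_one₀
              · exact div_nonneg (by linarith) hε.le
              · rw [div_le_one hε]; linarith
            have := (abs_le.1 h3).1
            linarith
      _ ≤ (Real.exp 1 * Real.exp (-(1 / 8 * |x|))) * (M * (Real.pi * (3 * ε))) := by
          rw [integral_const_mul]
          gcongr
      _ = _ := by ring
  intro x ε hε hε1
  rcases hε.eq_or_lt with rfl | hε0
  -- The bump needs positive width; for `ε = 0` the point is covered by arbitrarily short intervals.
  · have h0 : ∀ δ : ℝ, 0 < δ →
        (stdPi n).real {w | diagQuad l a w ∈ Set.Icc x (x + 0)} ≤ 0 + δ := by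
      intro δ hδ
      set Q := Real.exp 1 * (M * (Real.pi * 3)) * Real.exp (-(1 / 8 * |x|)) with hQ
      have hQ0 : 0 < Q := by positivity
      have hmin : 0 < min 1 (δ / Q) := lt_min one_pos (by positivity)
      calc _ ≤ (stdPi n).real {w | diagQuad l a w ∈ Set.Icc x (x + min 1 (δ / Q))} := by
            refine measureReal_mono fun w hw => ?_
            exact ⟨hw.1, hw.2.trans (by linarith)⟩
        _ ≤ Q * min 1 (δ / Q) := by
            refine (hpos x _ hmin (min_le_left _ _)).trans_eq ?_
            rw [hQ]; ring
        _ ≤ Q * (δ / Q) := by gcongr; exact min_le_right _ _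
        _ = 0 + δ := by field_simp; ring
    have := le_of_forall_pos_le_add h0
    simpa using this
  · exact hpos x ε hε0 hε1

end UpperBound

/-! ### Cameron–Martin translation and sweeping along segments. -/

section Sweep

lemma lintegral_indicator_shift_gaussianReal (a : ℝ) (s : Set ℝ) (hs : MeasurableSet s) :
    ∫⁻ y, ((fun y => y + a) ⁻¹' s).indicator
      (fun y => ENNReal.ofReal (Real.exp (-(a * y) - a ^ 2 / 2))) y ∂(gaussianReal 0 1) =
      gaussianReal 0 1 s := by
  have hs' : MeasurableSet ((fun y => y + a) ⁻¹' s) := (measurable_add_const a) hs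
  rw [gaussianReal_apply 0 one_ne_zero, ← lintegral_indicator hs,
    ← lintegral_add_right_eq_self (μ := volume) _ a, gaussianReal_of_var_ne_zero 0 one_ne_zero,
    lintegral_withDensity_eq_lintegral_mul _ (measurable_gaussianPDF _ _)
      ((Measurable.ennreal_ofReal (by fun_prop)).indicator hs')]
  congr with y
  simp only [Pi.mul_apply]
  by_cases h : y + a ∈ s
  · rw [Set.indicator_of_mem (by exact h), Set.indicator_of_mem h, gaussianPDF, gaussianPDF,
      ← ENNReal.ofReal_mul (gaussianPDFReal_nonneg _ _ _), gaussianPDFReal_def]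
    congr 1
    simp only
    rw [mul_assoc, ← Real.exp_add]
    congr 2
    simp
    ring
  · rw [Set.indicator_of_notMem (by exact h), Set.indicator_of_notMem h, mul_zero]

/-- The density of the standard Gaussian measure with respect to its translate by `a`. -/
noncomputable def shiftDensity {n : ℕ} (a y : Fin n → ℝ) : ENNReal :=
  ENNReal.ofReal (Real.exp (-(∑ i, a i * y i) - (∑ i, a i ^ 2) / 2))

lemma measurable_shiftDensity {n : ℕ} {α : Type*} [MeasurableSpace α] {u v : α → Fin n → ℝ}
    (hu : Measurable u) (hv : Measurable v) : Measurable fun x => shiftDensity (u x) (v x) := by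
  unfold shiftDensity
  fun_prop

/-- Both the density and a box factor over coordinates, so the one-dimensional Cameron–Martin
formula suffices. -/
lemma stdPi_eq_map_withDensity {n : ℕ} (a : Fin n → ℝ) :
    ((stdPi n).withDensity (shiftDensity a)).map (fun y => y + a) = stdPi n := by
  refine (Measure.pi_eq fun s hs => ?_).symm
  have hm : Measurable fun y : Fin n → ℝ => y + a := measurable_add_const a
  have hpi : MeasurableSet (Set.univ.pi s) := MeasurableSet.univ_pi hs
  rw [Measure.map_apply hm hpi, withDensity_apply _ (hm hpi), ← lintegral_indicator (hm hpi)]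
  set φ : Fin n → ℝ → ENNReal := fun i => ((fun y => y + a i) ⁻¹' s i).indicator
      (fun y => ENNReal.ofReal (Real.exp (-(a i * y) - a i ^ 2 / 2))) with hφ
  have hφm : ∀ i, Measurable (φ i) := fun i =>
    (Measurable.ennreal_ofReal (by fun_prop)).indicator ((measurable_add_const (a i)) (hs i))
  have h1 : ((fun y => y + a) ⁻¹' Set.univ.pi s).indicator (shiftDensity a) =
      fun y => ∏ i, φ i (y i) := by
    ext y
    by_cases h : y + a ∈ Set.univ.pi s
    · rw [Set.indicator_of_mem (by exact h), shiftDensity]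
      have h' : ∀ i, φ i (y i) =
          ENNReal.ofReal (Real.exp (-(a i * y i) - a i ^ 2 / 2)) := fun i =>
        Set.indicator_of_mem (by exact h i (Set.mem_univ i)) _
      simp_rw [h']
      rw [← ENNReal.ofReal_prod_of_nonneg fun i _ => (Real.exp_pos _).le, ← Real.exp_sum,
        Finset.sum_sub_distrib, Finset.sum_neg_distrib, Finset.sum_div]
    · rw [Set.indicator_of_notMem (by exact h)]
      simp only [Set.mem_pi, Set.mem_univ, true_imp_iff, not_forall] at h
      obtain ⟨i, hi⟩ := h
      exact (Finset.prod_eq_zero (Finset.mem_univ i) (Set.indicator_of_notMem (by exact hi) _)).symm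
  rw [h1]
  refine (lintegral_prod_eq_prod_lintegral_of_indepFun Finset.univ
    (fun i (y : Fin n → ℝ) => φ i (y i)) (iIndepFun_pi fun i => (hφm i).aemeasurable)
    fun i => (hφm i).comp (measurable_pi_apply i)).trans ?_
  refine Finset.prod_congr rfl fun i _ => ?_
  rw [← lintegral_indicator_shift_gaussianReal (a i) (s i) (hs i),
    (measurePreserving_eval (fun _ : Fin n => gaussianReal 0 1) i).lintegral_comp (hφm i)]

lemma lintegral_stdPi_shift {n : ℕ} (a : Fin n → ℝ) (k : (Fin n → ℝ) → ENNReal)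
    (hk : Measurable k) :
    ∫⁻ y, shiftDensity a y * k (y + a) ∂(stdPi n) = ∫⁻ y, k y ∂(stdPi n) := by
  have hm : Measurable fun y : Fin n → ℝ => y + a := measurable_add_const a
  conv_rhs => rw [← stdPi_eq_map_withDensity a]
  have hd : Measurable (shiftDensity a) := measurable_shiftDensity measurable_const measurable_id
  have hk' : Measurable fun y => k (y + a) := hk.comp hm
  rw [lintegral_map hk hm, lintegral_withDensity_eq_lintegral_mul _ hd hk']
  rfl

/-- A function crossing the interval `[x, x + ε]` at speed at most `M` spends time at least `ε / M`
in it. -/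
lemma le_volume_crossing (q : ℝ → ℝ) (S M x ε : ℝ) (hS : 0 ≤ S) (hM : 0 < M)
    (hq : ∀ s ∈ Set.Icc 0 S, ∀ t ∈ Set.Icc 0 S, |q s - q t| ≤ M * |s - t|)
    (h0 : q 0 ≤ x) (h1 : x + ε ≤ q S) :
    ENNReal.ofReal (ε / M) ≤ volume {s | s ∈ Set.Icc 0 S ∧ q s ∈ Set.Icc x (x + ε)} := by
  have hlip : LipschitzOnWith M.toNNReal q (Set.Icc 0 S) :=
    LipschitzOnWith.of_dist_le_mul fun s hs t ht => by
      rw [Real.dist_eq, Real.dist_eq, Real.coe_toNNReal _ hM.le]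
      exact hq s hs t ht
  set E := {s | s ∈ Set.Icc 0 S ∧ q s ∈ Set.Icc x (x + ε)} with hE
  -- The intermediate value theorem covers the interval, and a Lipschitz map enlarges length by at
  -- most `M`.
  have himg : Set.Icc x (x + ε) ⊆ q '' E := by
    intro y hy
    obtain ⟨s, hs, rfl⟩ := intermediate_value_Icc hS hlip.continuousOn
      (⟨h0.trans hy.1, hy.2.trans h1⟩ : y ∈ Set.Icc (q 0) (q S))
    exact ⟨s, ⟨hs, hy⟩, rfl⟩
  have hH := (hlip.mono (fun s hs => hs.1 : E ⊆ Set.Icc 0 S)).hausdorffMeasure_image_le zero_le_one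
  rw [hausdorffMeasure_real, ENNReal.rpow_one] at hH
  have h2 : ENNReal.ofReal ε ≤ ENNReal.ofReal M * volume E := by
    calc ENNReal.ofReal ε = volume (Set.Icc x (x + ε)) := by rw [Real.volume_Icc]; congr 1; ring
      _ ≤ volume (q '' E) := measure_mono himg
      _ ≤ _ := hH
  rw [ENNReal.ofReal_div_of_pos hM]
  refine ENNReal.div_le_of_le_mul ?_
  rwa [mul_comm]

/-- For each fixed `s`, the shift by `s • u` weighted by its density preserves the measure; `u`
depends only on the first factor, so this holds fibrewise. Integrating over `s ∈ [0, S]` and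
exchanging integrals compares `S` times the target probability with the time that paths started in
`E` spend in the interval. There the density is bounded below through `K` and `R`. -/
theorem sweep_le {α : Type*} [MeasurableSpace α] (μ : Measure α) [IsProbabilityMeasure μ] {n : ℕ}
    (u : α → Fin n → ℝ) (hu : Measurable u) (h : α × (Fin n → ℝ) → ℝ) (hh : Measurable h)
    (E : Set (α × (Fin n → ℝ))) (hE : MeasurableSet E) (S M K R x ε : ℝ) (hS : 0 < S) (hM : 0 < M)
    (hK : 0 ≤ K) (hε : 0 ≤ ε)
    (hlip : ∀ w ∈ E, ∀ s ∈ Set.Icc 0 S, ∀ t ∈ Set.Icc 0 S,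
      |h (w.1, w.2 + s • u w.1) - h (w.1, w.2 + t • u w.1)| ≤ M * |s - t|)
    (h0 : ∀ w ∈ E, h w ≤ x) (h1 : ∀ w ∈ E, x + ε ≤ h (w.1, w.2 + S • u w.1))
    (huK : ∀ w ∈ E, ∑ i, u w.1 i * w.2 i ≤ K) (huR : ∀ w ∈ E, ∑ i, u w.1 i ^ 2 ≤ R) :
    Real.exp (-(S * K) - S ^ 2 * R / 2) * (ε / (S * M)) * (μ.prod (stdPi n)).real E ≤
      (μ.prod (stdPi n)).real {w | h w ∈ Set.Icc x (x + ε)} := by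
  set ν := μ.prod (stdPi n) with hν
  set I := {w | h w ∈ Set.Icc x (x + ε)} with hI
  have hIm : MeasurableSet I := hh measurableSet_Icc
  set c := ENNReal.ofReal (Real.exp (-(S * K) - S ^ 2 * R / 2)) with hc
  set T : (α × (Fin n → ℝ)) × ℝ → α × (Fin n → ℝ) := fun p => (p.1.1, p.1.2 + p.2 • u p.1.1)
    with hT
  have hTm : Measurable T := by fun_prop
  set ρ : (α × (Fin n → ℝ)) × ℝ → ENNReal := fun p => shiftDensity (p.2 • u p.1.1) p.1.2 with hρ
  have hρm : Measurable ρ := measurable_shiftDensity (by fun_prop) (by fun_prop)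
  set ind : α × (Fin n → ℝ) → ENNReal := I.indicator 1 with hind
  have hindm : Measurable ind := measurable_one.indicator hIm
  have hshift : ∀ s : ℝ, ∫⁻ w, ρ (w, s) * ind (T (w, s)) ∂ν = ν I := fun s => by
    have hm : Measurable fun w : α × (Fin n → ℝ) => ρ (w, s) * ind (T (w, s)) := by fun_prop
    rw [hν, lintegral_prod _ hm.aemeasurable]
    have : ∀ X : α, ∫⁻ y, ρ ((X, y), s) * ind (T ((X, y), s)) ∂(stdPi n) =
        ∫⁻ y, ind (X, y) ∂(stdPi n) := fun X =>
      lintegral_stdPi_shift (s • u X) (fun y => ind (X, y)) (by fun_prop)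
    simp_rw [this]
    rw [← lintegral_prod _ hindm.aemeasurable, hind, lintegral_indicator_one hIm]
  have hρge : ∀ w ∈ E, ∀ s ∈ Set.Icc 0 S, c ≤ ρ (w, s) := by
    rintro w hw s ⟨hs0, hsS⟩
    refine ENNReal.ofReal_le_ofReal (Real.exp_le_exp.2 ?_)
    have e1 : ∑ i, (s • u w.1) i * w.2 i = s * ∑ i, u w.1 i * w.2 i := by
      simp [Finset.mul_sum, mul_assoc]
    have e2 : ∑ i, (s • u w.1) i ^ 2 = s ^ 2 * ∑ i, u w.1 i ^ 2 := by
      simp [Finset.mul_sum, mul_pow]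
    simp only
    rw [e1, e2]
    have a1 : s * ∑ i, u w.1 i * w.2 i ≤ S * K :=
      (mul_le_mul_of_nonneg_left (huK w hw) hs0).trans (mul_le_mul_of_nonneg_right hsS hK)
    have hR : 0 ≤ R := (Finset.sum_nonneg fun i _ => sq_nonneg _).trans (huR w hw)
    have a2 : s ^ 2 * ∑ i, u w.1 i ^ 2 ≤ S ^ 2 * R :=
      (mul_le_mul_of_nonneg_left (huR w hw) (sq_nonneg s)).trans
        (mul_le_mul_of_nonneg_right (pow_le_pow_left₀ hs0 hsS 2) hR)
    linarith
  have hEind : Measurable (E.indicator (1 : α × (Fin n → ℝ) → ENNReal)) :=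
    measurable_one.indicator hE
  have hmain : c * (ENNReal.ofReal (ε / M) * ν E) ≤ ENNReal.ofReal S * ν I := by
    calc c * (ENNReal.ofReal (ε / M) * ν E)
        = ∫⁻ w, E.indicator 1 w * (c * ENNReal.ofReal (ε / M)) ∂ν := by
          rw [lintegral_mul_const _ hEind, lintegral_indicator_one hE]; ring
      _ ≤ ∫⁻ w, (∫⁻ s in Set.Icc 0 S, ρ (w, s) * ind (T (w, s))) ∂ν := by
          refine lintegral_mono fun w => ?_
          by_cases hw : w ∈ E
          · rw [Set.indicator_of_mem hw, Pi.one_apply, one_mul]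
            have hset : MeasurableSet {s : ℝ | h (T (w, s)) ∈ Set.Icc x (x + ε)} :=
              (by fun_prop : Measurable fun s => h (T (w, s))) measurableSet_Icc
            calc c * ENNReal.ofReal (ε / M)
                ≤ c * volume {s | s ∈ Set.Icc 0 S ∧ h (T (w, s)) ∈ Set.Icc x (x + ε)} := by
                  gcongr
                  refine le_volume_crossing (fun s => h (T (w, s))) S M x ε hS.le hM
                    (hlip w hw) ?_ (h1 w hw)
                  simpa [hT] using h0 w hw
              _ = ∫⁻ s in Set.Icc 0 S,
                    c * {s : ℝ | h (T (w, s)) ∈ Set.Icc x (x + ε)}.indicator 1 s := by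
                  rw [lintegral_const_mul _ (measurable_one.indicator hset),
                    lintegral_indicator_one hset, Measure.restrict_apply hset, Set.inter_comm]
                  rfl
              _ ≤ _ := by
                  refine setLIntegral_mono (by fun_prop) fun s hs => ?_
                  exact mul_le_mul' (hρge w hw s hs) le_rfl
          · rw [Set.indicator_of_notMem hw, zero_mul]
            exact zero_le
      _ = ∫⁻ s in Set.Icc 0 S, ∫⁻ w, ρ (w, s) * ind (T (w, s)) ∂ν := by
          rw [lintegral_lintegral_swap]
          exact Measurable.aemeasurable (by simp only [Function.uncurry_def]; fun_prop)
      _ = ENNReal.ofReal S * ν I := by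
          simp_rw [hshift]
          rw [lintegral_const, Measure.restrict_apply MeasurableSet.univ, Set.univ_inter,
            Real.volume_Icc, sub_zero, mul_comm]
  have hreal := ENNReal.toReal_mono (ENNReal.mul_ne_top ENNReal.ofReal_ne_top
    (measure_ne_top ν I)) hmain
  rw [ENNReal.toReal_mul, ENNReal.toReal_mul, ENNReal.toReal_mul, hc,
    ENNReal.toReal_ofReal (Real.exp_pos _).le, ENNReal.toReal_ofReal (by positivity),
    ENNReal.toReal_ofReal hS.le] at hreal
  change Real.exp _ * (ε / M * ν.real E) ≤ S * ν.real I at hreal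
  rw [mul_comm S M, ← div_div]
  calc _ = (Real.exp (-(S * K) - S ^ 2 * R / 2) * (ε / M * ν.real E)) / S := by ring
    _ ≤ ν.real I := by
      rw [div_le_iff₀ hS]; linarith

end Sweep

/-! ### Moments, and the probability of being nonpositive. -/

section Moments

lemma integrable_pow_gaussianReal (k : ℕ) : Integrable (fun x : ℝ => x ^ k) (gaussianReal 0 1) := by
  rcases Nat.eq_zero_or_pos k with rfl | hk
  · simp
  · have := (memLp_id_gaussianReal (μ := 0) (v := 1) k).integrable_norm_pow hk.ne'
    rw [← integrable_norm_iff (by fun_prop)]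
    simpa using this

lemma integral_pow_gaussianReal (k : ℕ) :
    ∫ x, x ^ k ∂(gaussianReal 0 1) = iteratedDeriv k (fun t : ℝ => Real.exp (t ^ 2 / 2)) 0 := by
  have h := iteratedDeriv_mgf_zero (X := id) (μ := gaussianReal 0 1) (by simp) k
  rw [mgf_id_gaussianReal] at h
  simp only [zero_mul, NNReal.coe_one, one_mul, zero_add] at h
  rw [h]
  rfl

lemma deriv_mul_exp_sq (p p' : ℝ → ℝ) (hp : ∀ t, HasDerivAt p (p' t) t) :
    deriv (fun t : ℝ => p t * Real.exp (t ^ 2 / 2)) =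
      fun t => (p' t + t * p t) * Real.exp (t ^ 2 / 2) := by
  ext t
  have h1 : HasDerivAt (fun t : ℝ => t ^ 2 / 2) t t := by
    have := (hasDerivAt_pow 2 t).div_const 2
    simpa using this
  rw [((hp t).fun_mul h1.exp).deriv]
  ring

lemma iteratedDeriv_exp_sq :
    iteratedDeriv 2 (fun t : ℝ => Real.exp (t ^ 2 / 2)) 0 = 1 ∧
    iteratedDeriv 3 (fun t : ℝ => Real.exp (t ^ 2 / 2)) 0 = 0 ∧
    iteratedDeriv 4 (fun t : ℝ => Real.exp (t ^ 2 / 2)) 0 = 3 := by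
  have d1 : iteratedDeriv 1 (fun t : ℝ => Real.exp (t ^ 2 / 2)) =
      fun t => t * Real.exp (t ^ 2 / 2) := by
    rw [iteratedDeriv_one]
    simpa using deriv_mul_exp_sq (fun _ => 1) (fun _ => 0) fun t => hasDerivAt_const t 1
  have d2 : iteratedDeriv 2 (fun t : ℝ => Real.exp (t ^ 2 / 2)) =
      fun t => (1 + t * t) * Real.exp (t ^ 2 / 2) := by
    rw [iteratedDeriv_succ, d1, deriv_mul_exp_sq (fun t => t) (fun _ => 1) hasDerivAt_id]
  have d3 : iteratedDeriv 3 (fun t : ℝ => Real.exp (t ^ 2 / 2)) =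
      fun t => (2 * t + t * (1 + t * t)) * Real.exp (t ^ 2 / 2) := by
    rw [iteratedDeriv_succ, d2, deriv_mul_exp_sq (fun t => 1 + t * t) (fun t => 2 * t) fun t =>
      (((hasDerivAt_id' t).fun_mul (hasDerivAt_id' t)).const_add 1).congr_deriv (by ring)]
  have d4 : iteratedDeriv 4 (fun t : ℝ => Real.exp (t ^ 2 / 2)) =
      fun t => ((2 + (1 + 3 * (t * t))) + t * (2 * t + t * (1 + t * t))) *
        Real.exp (t ^ 2 / 2) := by
    rw [iteratedDeriv_succ, d3, deriv_mul_exp_sq (fun t => 2 * t + t * (1 + t * t))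
      (fun t => 2 + (1 + 3 * (t * t))) fun t =>
      (((hasDerivAt_id' t).const_mul 2).fun_add ((hasDerivAt_id' t).fun_mul
        (((hasDerivAt_id' t).fun_mul (hasDerivAt_id' t)).const_add 1))).congr_deriv (by ring)]
  refine ⟨?_, ?_, ?_⟩
  · rw [d2]; simp
  · rw [d3]; simp
  · rw [d4]; norm_num

lemma memLp_quad_gaussianReal (l a : ℝ) :
    MemLp (fun w : ℝ => l * (w ^ 2 - 1) + a * w) 2 (gaussianReal 0 1) := by
  rw [memLp_two_iff_integrable_sq (by fun_prop)]
  have h : (fun w : ℝ => (l * (w ^ 2 - 1) + a * w) ^ 2) = fun w =>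
      l ^ 2 * w ^ 4 + 2 * l * a * w ^ 3 + (a ^ 2 - 2 * l ^ 2) * w ^ 2 - 2 * l * a * w ^ 1 + l ^ 2 := by
    ext w; ring
  rw [h]
  have := integrable_pow_gaussianReal
  exact ((((this 4).const_mul _).add ((this 3).const_mul _)).add ((this 2).const_mul _)).sub
    ((this 1).const_mul _) |>.add (integrable_const _)

lemma integral_quad_gaussianReal (l a : ℝ) :
    ∫ w, (l * (w ^ 2 - 1) + a * w) ∂(gaussianReal 0 1) = 0 := by
  have h2 := integrable_pow_gaussianReal 2
  have h1 := integrable_pow_gaussianReal 1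
  have e2 := (integral_pow_gaussianReal 2).trans iteratedDeriv_exp_sq.1
  simp only [pow_one] at h1
  have h3 : Integrable (fun w : ℝ => l * (w ^ 2 - 1)) (gaussianReal 0 1) :=
    (h2.sub (integrable_const 1)).const_mul l
  rw [integral_add h3 (h1.const_mul a), integral_const_mul, integral_const_mul, integral_sub h2 (integrable_const 1), e2]
  simp

lemma variance_quad_gaussianReal (l a : ℝ) :
    Var[fun w => l * (w ^ 2 - 1) + a * w; gaussianReal 0 1] = 2 * l ^ 2 + a ^ 2 := by
  rw [variance_of_integral_eq_zero (by fun_prop) (integral_quad_gaussianReal l a)]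
  have h : (fun w : ℝ => (l * (w ^ 2 - 1) + a * w) ^ 2) = fun w =>
      l ^ 2 * w ^ 4 + (2 * l * a * w ^ 3 + ((a ^ 2 - 2 * l ^ 2) * w ^ 2 +
        ((-(2 * l * a)) * w ^ 1 + l ^ 2))) := by
    ext w; ring
  have hi := integrable_pow_gaussianReal
  have e2 := (integral_pow_gaussianReal 2).trans iteratedDeriv_exp_sq.1
  have e3 := (integral_pow_gaussianReal 3).trans iteratedDeriv_exp_sq.2.1
  have e4 := (integral_pow_gaussianReal 4).trans iteratedDeriv_exp_sq.2.2
  have e1 : ∫ x : ℝ, x ^ 1 ∂(gaussianReal 0 1) = 0 := by simp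
  have i0 : Integrable (fun _ : ℝ => l ^ 2) (gaussianReal 0 1) := integrable_const _
  have i1 := ((hi 1).const_mul (-(2 * l * a))).add i0
  have i2 := ((hi 2).const_mul (a ^ 2 - 2 * l ^ 2)).add i1
  have i3 := ((hi 3).const_mul (2 * l * a)).add i2
  rw [h]
  refine (integral_add ((hi 4).const_mul (l ^ 2)) i3).trans ?_
  refine (congrArg _ (integral_add ((hi 3).const_mul (2 * l * a)) i2)).trans ?_
  refine (congrArg _ (congrArg _ (integral_add ((hi 2).const_mul (a ^ 2 - 2 * l ^ 2)) i1))).trans ?_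
  refine (congrArg _ (congrArg _ (congrArg _
    (integral_add ((hi 1).const_mul (-(2 * l * a))) i0)))).trans ?_
  rw [integral_const_mul, integral_const_mul, integral_const_mul, integral_const_mul, e1, e2, e3, e4]
  simp
  ring

variable {n : ℕ} (l a : Fin n → ℝ)

lemma memLp_diagQuad : MemLp (diagQuad l a) 2 (stdPi n) := by
  have h : diagQuad l a = fun w => ∑ i, (l i * (w i ^ 2 - 1) + a i * w i) := rfl
  rw [h]
  exact memLp_finsetSum _ fun i _ => (memLp_quad_gaussianReal (l i) (a i)).comp_measurePreserving
    (measurePreserving_eval (fun _ : Fin n => gaussianReal 0 1) i)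

lemma integral_diagQuad : ∫ w, diagQuad l a w ∂(stdPi n) = 0 := by
  unfold diagQuad
  rw [integral_finsetSum]
  · refine Finset.sum_eq_zero fun i _ => ?_
    rw [← integral_quad_gaussianReal (l i) (a i),
      ← (measurePreserving_eval (fun _ : Fin n => gaussianReal 0 1) i).map_eq,
      integral_map (measurable_pi_apply i).aemeasurable (by fun_prop)]
  · exact fun i _ => ((memLp_quad_gaussianReal (l i) (a i)).comp_measurePreserving
      (measurePreserving_eval (fun _ : Fin n => gaussianReal 0 1) i)).integrable one_le_two

lemma variance_diagQuad : Var[diagQuad l a; stdPi n] = 2 * ∑ i, l i ^ 2 + ∑ i, a i ^ 2 := by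
  have h : diagQuad l a = ∑ i, fun w : Fin n → ℝ => (l i * (w i ^ 2 - 1) + a i * w i) := by
    ext w; simp [diagQuad]
  rw [h, variance_sum_pi (X := fun i w => l i * (w ^ 2 - 1) + a i * w)
    fun i => memLp_quad_gaussianReal (l i) (a i)]
  simp_rw [variance_quad_gaussianReal]
  rw [Finset.sum_add_distrib, Finset.mul_sum]

lemma diagQuad_chebyshev (t : ℝ) (ht : 0 < t) :
    (stdPi n).real {w | t ≤ |diagQuad l a w|} ≤
      (2 * ∑ i, l i ^ 2 + ∑ i, a i ^ 2) / t ^ 2 := by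
  have h := meas_ge_le_variance_div_sq (memLp_diagQuad l a) ht
  rw [integral_diagQuad, variance_diagQuad] at h
  simp only [sub_zero] at h
  refine (ENNReal.toReal_mono ENNReal.ofReal_ne_top h).trans_eq (ENNReal.toReal_ofReal ?_)
  have h1 : 0 ≤ ∑ i, l i ^ 2 := Finset.sum_nonneg fun i _ => sq_nonneg _
  have h2 : 0 ≤ ∑ i, a i ^ 2 := Finset.sum_nonneg fun i _ => sq_nonneg _
  positivity

/-- A centred random variable of unit variance and bounded fourth moment is nonpositive with
probability bounded below. -/
lemma le_prob_nonpos_of_fourth_moment {Ω : Type*} [MeasurableSpace Ω] (P : Measure Ω)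
    [IsProbabilityMeasure P] (X : Ω → ℝ) (hX : Measurable X) (C : ℝ) (hC : 1 ≤ C)
    (i1 : Integrable X P) (i2 : Integrable (fun ω => X ω ^ 2) P)
    (i4 : Integrable (fun ω => X ω ^ 4) P) (h1 : ∫ ω, X ω ∂P = 0) (h2 : ∫ ω, X ω ^ 2 ∂P = 1)
    (h4 : ∫ ω, X ω ^ 4 ∂P ≤ C) : 1 / (10 * C ^ 2) ≤ P.real {ω | X ω ≤ 0} := by
  have hC0 : 0 < C := by linarith
  have hms : MeasurableSet {ω | X ω ≤ 0} := hX measurableSet_Iic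
  -- For `X > 0` one of the two subtracted terms dominates `X²`, according as `X ≤ 2C` or not. The
  -- left side has expectation at least `1 - 0 - 1/2`, which bounds the probability below.
  have hpt : ∀ ω, X ω ^ 2 - 2 * C * X ω - (1 / (2 * C)) * X ω ^ 4 ≤
      5 * C ^ 2 * {ω | X ω ≤ 0}.indicator 1 ω := by
    intro ω
    set g := X ω with hg
    have e4 : (1 / (2 * C)) * g ^ 4 = g ^ 4 / (2 * C) := by ring
    rw [e4]
    by_cases h : g ≤ 0
    · rw [Set.indicator_of_mem (by exact h), Pi.one_apply, mul_one]
      have b1 : g ^ 2 ≤ C + g ^ 4 / (4 * C) := by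
        have : 0 ≤ (g ^ 2 - 2 * C) ^ 2 / (4 * C) := by positivity
        have e : (g ^ 2 - 2 * C) ^ 2 / (4 * C) = C + g ^ 4 / (4 * C) - g ^ 2 := by
          field_simp; ring
        linarith
      have b2 : -(2 * C * g) ≤ 4 * C ^ 2 + g ^ 4 / (4 * C) := by
        rcases le_total (-(2 * C)) g with h' | h'
        · have : 0 ≤ g ^ 4 / (4 * C) := by positivity
          nlinarith
        · have : -(2 * C * g) ≤ g ^ 4 / (4 * C) := by
            rw [le_div_iff₀ (by positivity)]
            have e1 : (2 * C) ^ 3 ≤ (-g) ^ 3 := pow_le_pow_left₀ (by positivity) (by linarith) 3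
            have e2 := mul_le_mul_of_nonneg_left e1 (by linarith : 0 ≤ -g)
            have e3 : C ^ 2 ≤ C ^ 3 := pow_le_pow_right₀ hC (by norm_num)
            have e5 := mul_le_mul_of_nonneg_left e3 (by linarith : 0 ≤ -g)
            nlinarith
          have : 0 ≤ C ^ 2 := by positivity
          linarith
      have e : g ^ 4 / (2 * C) = g ^ 4 / (4 * C) + g ^ 4 / (4 * C) := by field_simp; ring
      nlinarith
    · rw [Set.indicator_of_notMem (by exact h), mul_zero]
      push Not at h
      rcases le_total g (2 * C) with h' | h'
      · have : 0 ≤ g ^ 4 / (2 * C) := by positivity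
        nlinarith
      · have : g ^ 2 ≤ g ^ 4 / (2 * C) := by
          rw [le_div_iff₀ (by positivity)]
          have e1 : 2 * C ≤ g ^ 2 := by nlinarith
          nlinarith [mul_le_mul_of_nonneg_left e1 (sq_nonneg g)]
        have : 0 ≤ C * g := by positivity
        linarith
  have hint : Integrable (fun ω => X ω ^ 2 - 2 * C * X ω - (1 / (2 * C)) * X ω ^ 4) P :=
    (i2.sub (i1.const_mul _)).sub (i4.const_mul _)
  have hind : Integrable ({ω | X ω ≤ 0}.indicator (1 : Ω → ℝ)) P :=
    (integrable_const (1 : ℝ)).indicator hms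
  have hle := integral_mono hint (hind.const_mul (5 * C ^ 2)) hpt
  have i3 : Integrable (fun ω => X ω ^ 2 - 2 * C * X ω) P := i2.sub (i1.const_mul _)
  rw [integral_sub i3 (i4.const_mul _), integral_sub i2 (i1.const_mul _),
    integral_const_mul, integral_const_mul, integral_const_mul, h1, h2,
    integral_indicator_one hms] at hle
  have h5 : (1 / (2 * C)) * ∫ ω, X ω ^ 4 ∂P ≤ 1 / 2 := by
    calc _ ≤ (1 / (2 * C)) * C := by gcongr
      _ = 1 / 2 := by field_simp
  rw [div_le_iff₀ (by positivity)]
  nlinarith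

lemma diagQuad_le_prob_nonpos (hvar : 2 * ∑ i, l i ^ 2 + ∑ i, a i ^ 2 = 1) :
    1 / (10 * 393216 ^ 2) ≤ (stdPi n).real {w | diagQuad l a w ≤ 0} := by
  have hl : ∀ i, |l i| ≤ 1 := fun i => by
    have h1 : l i ^ 2 ≤ ∑ i, l i ^ 2 :=
      Finset.single_le_sum (f := fun i => l i ^ 2) (fun i _ => sq_nonneg _) (Finset.mem_univ i)
    have h2 : 0 ≤ ∑ i, a i ^ 2 := Finset.sum_nonneg fun i _ => sq_nonneg _
    rw [← sq_le_one_iff_abs_le_one]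
    linarith [sq_nonneg (l i)]
  have hi : ∀ θ : ℝ, |θ| = 1 / 8 → Integrable (fun w => Real.exp (θ * diagQuad l a w)) (stdPi n) ∧
      ∫ w, Real.exp (θ * diagQuad l a w) ∂(stdPi n) ≤ 2 := by
    intro θ hθ
    refine ⟨integrable_exp_diagQuad l a θ fun i => ?_, ?_⟩
    · calc θ * l i ≤ |θ * l i| := le_abs_self _
        _ = |θ| * |l i| := abs_mul _ _
        _ < 1 / 2 := by rw [hθ]; linarith [hl i]
    · have h := norm_integral_cexp_diagQuad_pow_le l a θ 0 hvar hθ.le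
      simp only [Complex.ofReal_zero, zero_mul, add_zero, ← Complex.ofReal_mul,
        ← Complex.ofReal_exp] at h
      rw [integral_complex_ofReal, Complex.norm_real, Real.norm_of_nonneg
        (integral_nonneg fun w => (Real.exp_pos _).le)] at h
      simp at h
      have h0 : 0 ≤ ∫ w, Real.exp (θ * diagQuad l a w) ∂(stdPi n) :=
        integral_nonneg fun w => (Real.exp_pos _).le
      by_contra hcon
      push Not at hcon
      have := pow_le_pow_left₀ (by norm_num) hcon.le 4
      linarith
  obtain ⟨ip, bp⟩ := hi (1 / 8) (by norm_num)
  obtain ⟨im, bm⟩ := hi (-(1 / 8)) (by norm_num)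
  -- From `y⁴/4! ≤ exp|y|` at `y = g/8`: `98304 = 24 · 8⁴`. The two exponential moments sum to at
  -- most 4, whence `393216`.
  have hpt : ∀ w, diagQuad l a w ^ 4 ≤ 98304 * (Real.exp (1 / 8 * diagQuad l a w) +
      Real.exp (-(1 / 8) * diagQuad l a w)) := by
    intro w
    set g := diagQuad l a w
    have h1 := Real.pow_div_factorial_le_exp |1 / 8 * g| (abs_nonneg _) 4
    have h2 : |1 / 8 * g| ^ 4 = g ^ 4 / 4096 := by
      rw [Even.pow_abs (by decide)]; ring
    rw [h2] at h1
    have h3 := Real.exp_abs_le (1 / 8 * g)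
    rw [← neg_mul] at h3
    norm_num [Nat.factorial] at h1 h3 ⊢
    linarith
  have hm := measurable_diagQuad l a
  have isum := (ip.add im).const_mul 98304
  have i4 : Integrable (fun w => diagQuad l a w ^ 4) (stdPi n) :=
    isum.mono' (by fun_prop) (ae_of_all _ fun w => by
      rw [Real.norm_of_nonneg (by positivity)]; exact hpt w)
  refine le_prob_nonpos_of_fourth_moment (stdPi n) _ hm 393216 (by norm_num)
    ((memLp_diagQuad l a).integrable one_le_two) (memLp_diagQuad l a).integrable_sq i4
    (integral_diagQuad l a) ?_ ?_
  · rw [← variance_of_integral_eq_zero hm.aemeasurable (integral_diagQuad l a),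
      variance_diagQuad, hvar]
  · calc _ ≤ _ := integral_mono i4 isum hpt
      _ ≤ _ := by
        rw [integral_const_mul]
        have : ∫ w, ((fun w => Real.exp (1 / 8 * diagQuad l a w)) +
          fun w => Real.exp (-(1 / 8) * diagQuad l a w)) w ∂(stdPi n) ≤ 4 := by
          rw [integral_add' ip im]; linarith
        linarith

end Moments

/-! ### Splitting a Gaussian vector into two independent halves. -/

section Doubling

/-- The normalised sum of two vectors. -/
noncomputable def normSum {n : ℕ} (p : (Fin n → ℝ) × (Fin n → ℝ)) : Fin n → ℝ :=
  fun i => (p.1 i + p.2 i) / √2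

lemma measurable_normSum {n : ℕ} : Measurable (normSum (n := n)) := by
  unfold normSum
  fun_prop

lemma map_add_div_sqrt_two :
    ((gaussianReal 0 1).prod (gaussianReal 0 1)).map (fun p => (p.1 + p.2) / √2) =
      gaussianReal 0 1 := by
  have h := gaussianReal_add_gaussianReal_of_indepFun
    (P := (gaussianReal 0 1).prod (gaussianReal 0 1))
    (indepFun_prod (X := id) (Y := id) measurable_id measurable_id)
    (m₁ := 0) (m₂ := 0) (v₁ := 1) (v₂ := 1) (by simp) (by simp)
  have h2 : (fun p : ℝ × ℝ => (p.1 + p.2) / √2) =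
      (fun x => x / √2) ∘ ((fun p => id p.1) + fun p => id p.2) := by
    ext p; simp
  rw [h2, ← Measure.map_map (by fun_prop) (by fun_prop), h, gaussianReal_map_div_const]
  congr 1
  · simp
  · ext
    norm_num

lemma measurePreserving_normSum (n : ℕ) :
    MeasurePreserving normSum ((stdPi n).prod (stdPi n)) (stdPi n) := by
  have h1 := (measurePreserving_arrowProdEquivProdArrow ℝ ℝ (Fin n)
    (fun _ => gaussianReal 0 1) (fun _ => gaussianReal 0 1)).symm
  have h2 : MeasurePreserving (fun (w : Fin n → ℝ × ℝ) i => ((w i).1 + (w i).2) / √2)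
      (Measure.pi fun _ => (gaussianReal 0 1).prod (gaussianReal 0 1)) (stdPi n) := by
    refine ⟨by fun_prop, ?_⟩
    have : ∀ _ : Fin n, SigmaFinite (((gaussianReal 0 1).prod (gaussianReal 0 1)).map
      (fun p : ℝ × ℝ => (p.1 + p.2) / √2)) := fun _ => by
        rw [map_add_div_sqrt_two]; infer_instance
    rw [Measure.pi_map_pi (f := fun _ (p : ℝ × ℝ) => (p.1 + p.2) / √2) fun _ => by fun_prop]
    simp_rw [map_add_div_sqrt_two]
  exact h2.comp h1

end Doubling

/-! ### Choice of direction and the lower bound. -/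

section LowerBound

variable {n : ℕ}

lemma diagQuad_normSum_shift (l a X Y u : Fin n → ℝ) (s : ℝ) :
    diagQuad l a (normSum (X, Y + s • u)) = diagQuad l a (normSum (X, Y)) +
      s * ∑ i, (l i * (X i + Y i) + a i / √2) * u i + s ^ 2 / 2 * ∑ i, l i * u i ^ 2 := by
  have h2 : √2 ^ 2 = 2 := Real.sq_sqrt (by norm_num)
  have h0 : √2 ≠ 0 := by positivity
  have h4 : √2 ^ 4 = 4 := by rw [show (4 : ℕ) = 2 * 2 from rfl, pow_mul, h2]; norm_num
  simp only [diagQuad, normSum, Pi.add_apply, Pi.smul_apply, smul_eq_mul]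
  rw [Finset.mul_sum, Finset.mul_sum, ← Finset.sum_add_distrib, ← Finset.sum_add_distrib]
  refine Finset.sum_congr rfl fun i _ => ?_
  simp only [div_pow, h2]
  field_simp
  ring

lemma abs_quadratic_sub_le (b c d S M s t : ℝ) (hs : s ∈ Set.Icc 0 S) (ht : t ∈ Set.Icc 0 S)
    (hM : |b| + S * |d| ≤ M) :
    |(c + s * b + s ^ 2 / 2 * d) - (c + t * b + t ^ 2 / 2 * d)| ≤ M * |s - t| := by
  have e : (c + s * b + s ^ 2 / 2 * d) - (c + t * b + t ^ 2 / 2 * d) =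
      (b + (s + t) / 2 * d) * (s - t) := by ring
  rw [e, abs_mul]
  refine mul_le_mul_of_nonneg_right (le_trans ?_ hM) (abs_nonneg _)
  refine (abs_add_le _ _).trans ?_
  rw [abs_mul, abs_of_nonneg (by linarith [hs.1, ht.1] : 0 ≤ (s + t) / 2)]
  gcongr
  linarith [hs.2, ht.2]

lemma stdPi_prod_real_eq (s : Set (Fin n → ℝ)) (hs : MeasurableSet s) :
    ((stdPi n).prod (stdPi n)).real (normSum ⁻¹' s) = (stdPi n).real s := by
  rw [measureReal_def, (measurePreserving_normSum n).measure_preimage hs.nullMeasurableSet,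
    measureReal_def]

lemma linear_chebyshev (b : Fin n → ℝ) (t : ℝ) (ht : 0 < t) :
    (stdPi n).real {w | t ≤ |∑ i, b i * w i|} ≤ (∑ i, b i ^ 2) / t ^ 2 := by
  simpa [diagQuad] using diagQuad_chebyshev 0 b t ht

/-- Chebyshev in the second variable with the first frozen, then Fubini. -/
lemma prod_linear_chebyshev {α : Type*} [MeasurableSpace α] (μ : Measure α)
    [IsProbabilityMeasure μ] (b : α → Fin n → ℝ) (hb : Measurable b) (G : Set α)
    (hG : MeasurableSet G) (B t : ℝ) (ht : 0 < t) (hB : 0 ≤ B)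
    (hbound : ∀ X ∈ G, ∑ i, b X i ^ 2 ≤ B) :
    (μ.prod (stdPi n)).real {p | p.1 ∈ G ∧ t ≤ |∑ i, b p.1 i * p.2 i|} ≤ B / t ^ 2 := by
  have hm : MeasurableSet {p : α × (Fin n → ℝ) | p.1 ∈ G ∧ t ≤ |∑ i, b p.1 i * p.2 i|} :=
    have h2 : Measurable fun p : α × (Fin n → ℝ) => |∑ i, b p.1 i * p.2 i| := by fun_prop
    (measurable_fst hG).inter (measurableSet_le measurable_const h2)
  refine ENNReal.toReal_le_of_le_ofReal (by positivity) ?_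
  rw [Measure.prod_apply hm]
  calc _ ≤ ∫⁻ _, ENNReal.ofReal (B / t ^ 2) ∂μ := by
        refine lintegral_mono fun X => ?_
        by_cases hX : X ∈ G
        · have h := (linear_chebyshev (b X) t ht).trans
            (div_le_div_of_nonneg_right (hbound X hX) (sq_nonneg t))
          have h' := (ENNReal.le_ofReal_iff_toReal_le (measure_ne_top _ _) (by positivity)).2 h
          refine le_trans (measure_mono ?_) h'
          exact fun y hy => hy.2
        · have : Prod.mk X ⁻¹' {p : α × (Fin n → ℝ) | p.1 ∈ G ∧ t ≤ |∑ i, b p.1 i * p.2 i|} = ∅ := by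
            ext y; simp [hX]
          rw [this, measure_empty]
          exact zero_le
    _ = _ := by simp

lemma measureReal_sub_le_of_subset {Ω : Type*} [MeasurableSpace Ω] (P : Measure Ω)
    [IsProbabilityMeasure P] (A E B₁ B₂ B₃ B₄ : Set Ω)
    (h : A ⊆ E ∪ (B₁ ∪ (B₂ ∪ (B₃ ∪ B₄)))) :
    P.real A - P.real B₁ - P.real B₂ - P.real B₃ - P.real B₄ ≤ P.real E := by
  have h0 := measureReal_mono (μ := P) h
  have h1 := measureReal_union_le (μ := P) E (B₁ ∪ (B₂ ∪ (B₃ ∪ B₄)))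
  have h2 := measureReal_union_le (μ := P) B₁ (B₂ ∪ (B₃ ∪ B₄))
  have h3 := measureReal_union_le (μ := P) B₂ (B₃ ∪ B₄)
  have h4 := measureReal_union_le (μ := P) B₃ B₄
  linarith

/-- Lower bound for the small ball probability when all eigenvalues are small. -/
lemma diagQuad_le_smallBall_of_small (l a : Fin n → ℝ)
    (hvar : 2 * ∑ i, l i ^ 2 + ∑ i, a i ^ 2 = 1) (c₀ A K S δ : ℝ) (hc₀ : 0 < c₀)
    (hprob : c₀ ≤ (stdPi n).real {w | diagQuad l a w ≤ 0})
    (hA : 0 ≤ A) (hK : 0 < K) (hKc : 1 / K ^ 2 ≤ c₀ / 8) (hS : S = 16 * (A + K + 1))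
    (hSδ : S * δ ≤ 1 / 8) (hδ : 768 * δ ^ 2 ≤ c₀) (hl : ∀ i, |l i| ≤ δ)
    (x ε : ℝ) (hx0 : 0 ≤ x) (hxA : x ≤ A) (hε0 : 0 ≤ ε) (hε1 : ε ≤ 1) :
    Real.exp (-(S * K) - S ^ 2 * 1 / 2) * (ε / (S * 2)) * (c₀ / 2) ≤
      (stdPi n).real {w | diagQuad l a w ∈ Set.Icc x (x + ε)} := by
  have h2 : √2 ^ 2 = 2 := Real.sq_sqrt (by norm_num)
  have hL : 0 ≤ ∑ i, l i ^ 2 := Finset.sum_nonneg fun i _ => sq_nonneg _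
  have ha : 0 ≤ ∑ i, a i ^ 2 := Finset.sum_nonneg fun i _ => sq_nonneg _
  have hl2 : ∀ i, l i ^ 2 ≤ δ ^ 2 := fun i => sq_le_sq' (by linarith [(abs_le.1 (hl i)).1])
    ((le_abs_self _).trans (hl i))
  set μ := stdPi n with hμ
  -- The gradient of `h (X, ·)` at `Y = 0`.
  set p : (Fin n → ℝ) → Fin n → ℝ := fun X i => l i * X i + a i / √2 with hp
  have hpm : Measurable p := by fun_prop
  set h : (Fin n → ℝ) × (Fin n → ℝ) → ℝ := fun w => diagQuad l a (normSum w) with hh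
  have hhm : Measurable h := (measurable_diagQuad l a).comp measurable_normSum
  -- The fluctuation about `1/2` is again a centred diagonal quadratic. Its variance is at most
  -- `2δ²`, so `G` is likely.
  have hpsum : ∀ X, ∑ i, p X i ^ 2 =
      1 / 2 + diagQuad (fun i => l i ^ 2) (fun i => √2 * l i * a i) X := by
    intro X
    have e : (1 / 2 : ℝ) = ∑ i, (l i ^ 2 + a i ^ 2 / 2) := by
      rw [Finset.sum_add_distrib, ← Finset.sum_div]; linarith
    rw [e, diagQuad, ← Finset.sum_add_distrib]
    refine Finset.sum_congr rfl fun i _ => ?_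
    simp only [hp]
    have h3 : a i / √2 = a i * √2 / 2 := by
      rw [div_eq_div_iff (by positivity) (by norm_num), mul_assoc, ← pow_two, h2]
    rw [h3]
    ring_nf
    rw [h2]
    ring
  set G : Set (Fin n → ℝ) := {X | 1 / 4 ≤ ∑ i, p X i ^ 2 ∧ ∑ i, p X i ^ 2 ≤ 1} with hG
  have hGm : MeasurableSet G :=
    have hm : Measurable fun X => ∑ i, p X i ^ 2 := by fun_prop
    (measurableSet_le measurable_const hm).inter (measurableSet_le hm measurable_const)
  set E : Set ((Fin n → ℝ) × (Fin n → ℝ)) := {w | h w ≤ 0 ∧ -K ≤ h w ∧ w.1 ∈ G ∧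
    |∑ i, (l i * p w.1 i) * w.2 i| ≤ 1 / 8 ∧ |∑ i, p w.1 i * w.2 i| ≤ K} with hE
  have hEm : MeasurableSet E := by
    have m1 : Measurable fun w : (Fin n → ℝ) × (Fin n → ℝ) => |∑ i, (l i * p w.1 i) * w.2 i| := by
      fun_prop
    have m2 : Measurable fun w : (Fin n → ℝ) × (Fin n → ℝ) => |∑ i, p w.1 i * w.2 i| := by
      fun_prop
    exact (measurableSet_le hhm measurable_const).inter
      ((measurableSet_le measurable_const hhm).inter
      ((measurable_fst hGm).inter ((measurableSet_le m1 measurable_const).inter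
      (measurableSet_le m2 measurable_const))))
  have hlp : ∀ X ∈ G, ∑ i, (l i * p X i) ^ 2 ≤ δ ^ 2 := by
    intro X hX
    calc ∑ i, (l i * p X i) ^ 2 ≤ ∑ i, δ ^ 2 * p X i ^ 2 := by
          refine Finset.sum_le_sum fun i _ => ?_
          rw [mul_pow]
          exact mul_le_mul_of_nonneg_right (hl2 i) (sq_nonneg _)
      _ = δ ^ 2 * ∑ i, p X i ^ 2 := by rw [Finset.mul_sum]
      _ ≤ δ ^ 2 := mul_le_of_le_one_right (sq_nonneg _) hX.2
  have hE2 : ∀ w ∈ E, |∑ i, l i * p w.1 i ^ 2| ≤ δ := by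
    intro w hw
    calc |∑ i, l i * p w.1 i ^ 2| ≤ ∑ i, |l i * p w.1 i ^ 2| := Finset.abs_sum_le_sum_abs _ _
      _ ≤ ∑ i, δ * p w.1 i ^ 2 := by
          refine Finset.sum_le_sum fun i _ => ?_
          rw [abs_mul, abs_of_nonneg (sq_nonneg (p w.1 i))]
          exact mul_le_mul_of_nonneg_right (hl i) (sq_nonneg _)
      _ = δ * ∑ i, p w.1 i ^ 2 := by rw [Finset.mul_sum]
      _ ≤ δ := by
        have hδ0 : 0 ≤ δ ∨ ∑ i, p w.1 i ^ 2 = 0 := by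
          rcases isEmpty_or_nonempty (Fin n) with hn | ⟨⟨i⟩⟩
          · right; simp
          · left; exact (abs_nonneg _).trans (hl i)
        rcases hδ0 with h' | h'
        · exact mul_le_of_le_one_right h' hw.2.2.1.2
        · have := hw.2.2.1.1
          rw [h'] at this; norm_num at this
  have hslope : ∀ w : (Fin n → ℝ) × (Fin n → ℝ),
      ∑ i, (l i * (w.1 i + w.2 i) + a i / √2) * p w.1 i =
        ∑ i, p w.1 i ^ 2 + ∑ i, (l i * p w.1 i) * w.2 i := by
    intro w
    rw [← Finset.sum_add_distrib]
    refine Finset.sum_congr rfl fun i _ => ?_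
    simp only [hp]; ring
  -- The exceptional sets cost `c₀/8 + 32δ² + 64δ² + c₀/8 ≤ 3c₀/8`.
  have hprobE : c₀ / 2 ≤ (μ.prod μ).real E := by
    have hsub := measureReal_sub_le_of_subset (μ.prod μ) (normSum ⁻¹' {w | diagQuad l a w ≤ 0}) E
      (normSum ⁻¹' {w | K ≤ |diagQuad l a w|})
      ({X | 1 / 4 ≤ |diagQuad (fun i => l i ^ 2) (fun i => √2 * l i * a i) X|} ×ˢ Set.univ)
      {w | w.1 ∈ G ∧ 1 / 8 ≤ |∑ i, (l i * p w.1 i) * w.2 i|}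
      {w | w.1 ∈ G ∧ K ≤ |∑ i, p w.1 i * w.2 i|} (by
        intro w hw
        by_contra hcon
        simp only [Set.mem_union, not_or, Set.mem_preimage, Set.mem_ofPred_eq, not_le, Set.mem_prod,
          Set.mem_univ, and_true, not_and] at hcon
        obtain ⟨n0, n1, n2, n3, n4⟩ := hcon
        have hwG : w.1 ∈ G := by
          have := abs_lt.1 n2
          constructor <;> rw [hpsum] <;> linarith
        exact n0 ⟨hw, (abs_lt.1 n1).1.le, hwG, (n3 hwG).le, (n4 hwG).le⟩)
    have m1 := stdPi_prod_real_eq {w | diagQuad l a w ≤ 0}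
      (measurableSet_le (measurable_diagQuad l a) measurable_const)
    have m2 := stdPi_prod_real_eq {w | K ≤ |diagQuad l a w|}
      (measurableSet_le measurable_const (measurable_diagQuad l a).abs)
    have b2 := diagQuad_chebyshev l a K hK
    rw [hvar] at b2
    have b3 := diagQuad_chebyshev (fun i => l i ^ 2) (fun i => √2 * l i * a i) (1 / 4) (by norm_num)
    have b3' : 2 * ∑ i, (l i ^ 2) ^ 2 + ∑ i, (√2 * l i * a i) ^ 2 ≤ 2 * δ ^ 2 := by
      have e1 : ∑ i, (l i ^ 2) ^ 2 ≤ δ ^ 2 * ∑ i, l i ^ 2 := by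
        rw [Finset.mul_sum]
        refine Finset.sum_le_sum fun i _ => ?_
        rw [pow_two (l i ^ 2)]
        exact mul_le_mul_of_nonneg_right (hl2 i) (sq_nonneg _)
      have e2 : ∑ i, (√2 * l i * a i) ^ 2 ≤ 2 * δ ^ 2 * ∑ i, a i ^ 2 := by
        rw [Finset.mul_sum]
        refine Finset.sum_le_sum fun i _ => ?_
        rw [mul_pow, mul_pow, h2]
        exact mul_le_mul_of_nonneg_right (by linarith [hl2 i]) (sq_nonneg _)
      have : 2 * δ ^ 2 = 2 * δ ^ 2 * (2 * ∑ i, l i ^ 2 + ∑ i, a i ^ 2) := by rw [hvar, mul_one]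
      have := mul_nonneg (sq_nonneg δ) hL
      nlinarith
    have m3 : (μ.prod μ).real
        ({X | 1 / 4 ≤ |diagQuad (fun i => l i ^ 2) (fun i => √2 * l i * a i) X|} ×ˢ Set.univ) ≤
        32 * δ ^ 2 := by
      rw [measureReal_prod_prod]
      simp only [probReal_univ, mul_one]
      refine b3.trans ?_
      rw [div_le_iff₀ (by norm_num)]
      linarith
    have m4 := prod_linear_chebyshev μ (fun X i => l i * p X i) (by fun_prop) G hGm (δ ^ 2) (1 / 8)
      (by norm_num) (sq_nonneg _) hlp
    have m5 := prod_linear_chebyshev μ p hpm G hGm 1 K hK zero_le_one fun X hX => hX.2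
    have m4' : δ ^ 2 / (1 / 8) ^ 2 = 64 * δ ^ 2 := by ring
    rw [m4'] at m4
    rw [m1, m2] at hsub
    linarith
  have hSpos : 0 < S := by rw [hS]; linarith
  have hsweep := sweep_le μ p hpm h hhm E hEm S 2 K 1 x ε hSpos two_pos hK.le hε0
    (fun w hw s hs t ht => by
      simp only [hh, diagQuad_normSum_shift, hslope]
      refine abs_quadratic_sub_le _ _ _ S 2 s t hs ht ?_
      have e1 := mul_le_mul_of_nonneg_left (hE2 w hw) hSpos.le
      have e2 := hw.2.2.2.1
      have e3 := abs_add_le (∑ i, p w.1 i ^ 2) (∑ i, (l i * p w.1 i) * w.2 i)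
      rw [abs_of_nonneg (Finset.sum_nonneg fun i _ => sq_nonneg (p w.1 i))] at e3
      have e4 := hw.2.2.1.2
      linarith)
    (fun w hw => hw.1.trans hx0)
    -- The initial slope is at least `1/4 - 1/8`, and curvature costs at most `Sδ/2 ≤ 1/16` on
    -- average. The rise is thus at least `S/16 = A + K + 1`, enough to go from `-K` beyond `x + ε`.
    (fun w hw => by
      simp only [hh, diagQuad_normSum_shift, hslope]
      have e0 : -K ≤ diagQuad l a (normSum (w.1, w.2)) := hw.2.1
      have e1 := (abs_le.1 (hE2 w hw)).1
      have e2 := (abs_le.1 hw.2.2.2.1).1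
      have e3 := hw.2.2.1.1
      have e4 : S * (1 / 8) ≤ S * (∑ i, p w.1 i ^ 2 + ∑ i, (l i * p w.1 i) * w.2 i) :=
        mul_le_mul_of_nonneg_left (by linarith) hSpos.le
      have e5 : S ^ 2 / 2 * (-δ) ≤ S ^ 2 / 2 * ∑ i, l i * p w.1 i ^ 2 :=
        mul_le_mul_of_nonneg_left e1 (by positivity)
      have e6 := mul_le_mul_of_nonneg_left hSδ hSpos.le
      have e7 : S / 16 = A + K + 1 := by rw [hS]; ring
      linarith)
    (fun w hw => (le_abs_self _).trans hw.2.2.2.2) (fun w hw => hw.2.2.1.2)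
  have hfin := stdPi_prod_real_eq {w | diagQuad l a w ∈ Set.Icc x (x + ε)}
    (measurable_diagQuad l a measurableSet_Icc)
  rw [← hfin]
  refine le_trans ?_ hsweep
  gcongr

/-- Lower bound for the small ball probability when some eigenvalue is large and positive. -/
lemma diagQuad_le_smallBall_of_large (l a : Fin n → ℝ)
    (hvar : 2 * ∑ i, l i ^ 2 + ∑ i, a i ^ 2 = 1) (c₀ A K S δ : ℝ) (hc₀ : 0 < c₀)
    (hprob : c₀ ≤ (stdPi n).real {w | diagQuad l a w ≤ 0})
    (hA : 0 ≤ A) (hK : 0 < K) (hKc : 1 / K ^ 2 ≤ c₀ / 8) (hS : S = (3 * K + A + 1) / δ)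
    (hδ0 : 0 < δ) (hδ1 : δ ≤ 1) (j : Fin n) (hl : δ ≤ l j)
    (x ε : ℝ) (hx0 : 0 ≤ x) (hxA : x ≤ A) (hε0 : 0 ≤ ε) (hε1 : ε ≤ 1) :
    Real.exp (-(S * (2 * K)) - S ^ 2 * 2 / 2) * (ε / (S * (2 * K + 1 + 2 * S))) * (c₀ / 2) ≤
      (stdPi n).real {w | diagQuad l a w ∈ Set.Icc x (x + ε)} := by
  have h2 : √2 ^ 2 = 2 := Real.sq_sqrt (by norm_num)
  have h2' : √2 * √2 = 2 := Real.mul_self_sqrt (by norm_num)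
  have h20 : 0 < √2 := by positivity
  have h22 : √2 ≤ 2 := by nlinarith
  have hL : 0 ≤ ∑ i, l i ^ 2 := Finset.sum_nonneg fun i _ => sq_nonneg _
  have ha : 0 ≤ ∑ i, a i ^ 2 := Finset.sum_nonneg fun i _ => sq_nonneg _
  have hlj : l j ≤ 1 := by
    have h1 : l j ^ 2 ≤ ∑ i, l i ^ 2 :=
      Finset.single_le_sum (f := fun i => l i ^ 2) (fun i _ => sq_nonneg _) (Finset.mem_univ j)
    nlinarith
  have haj : |a j| ≤ 1 := by
    have h1 : a j ^ 2 ≤ ∑ i, a i ^ 2 :=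
      Finset.single_le_sum (f := fun i => a i ^ 2) (fun i _ => sq_nonneg _) (Finset.mem_univ j)
    rw [← sq_le_one_iff_abs_le_one]
    linarith
  -- The orientation of the axis is chosen so that the linear term `a j` does not oppose the rise.
  obtain ⟨τ, hτ, hτa⟩ : ∃ τ : ℝ, |τ| = 1 ∧ 0 ≤ τ * a j := by
    rcases le_total 0 (a j) with h | h
    · exact ⟨1, by norm_num, by linarith⟩
    · exact ⟨-1, by norm_num, by linarith⟩
  have hτ2 : τ ^ 2 = 1 := by rw [← sq_abs, hτ, one_pow]
  set μ := stdPi n with hμ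
  -- The factor `√2` makes `normSum` move at unit speed.
  set u : Fin n → ℝ := Pi.single j (√2 * τ) with hu
  set h : (Fin n → ℝ) × (Fin n → ℝ) → ℝ := fun w => diagQuad l a (normSum w) with hh
  have hhm : Measurable h := (measurable_diagQuad l a).comp measurable_normSum
  set E : Set ((Fin n → ℝ) × (Fin n → ℝ)) := {w | h w ≤ 0 ∧ -K ≤ h w ∧
    |normSum w j| ≤ K ∧ |w.2 j| ≤ K} with hE
  have hjm : Measurable fun w : (Fin n → ℝ) × (Fin n → ℝ) => |normSum w j| :=
    ((measurable_pi_apply j).comp measurable_normSum).abs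
  have hEm : MeasurableSet E := by
    have hm : Measurable fun w : (Fin n → ℝ) × (Fin n → ℝ) => |w.2 j| := by fun_prop
    exact (measurableSet_le hhm measurable_const).inter
      ((measurableSet_le measurable_const hhm).inter
      ((measurableSet_le hjm measurable_const).inter (measurableSet_le hm measurable_const)))
  have hcoord : (stdPi n).real {w | K ≤ |w j|} ≤ 1 / K ^ 2 := by
    simpa [Pi.single_apply] using linear_chebyshev (Pi.single j (1 : ℝ)) K hK
  have hprobE : c₀ / 2 ≤ (μ.prod μ).real E := by
    have hsub := measureReal_sub_le_of_subset (μ.prod μ) (normSum ⁻¹' {w | diagQuad l a w ≤ 0}) E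
      (normSum ⁻¹' {w | K ≤ |diagQuad l a w|}) (normSum ⁻¹' {w | K ≤ |w j|})
      (Set.univ ×ˢ {w | K ≤ |w j|}) ∅ (by
        intro w hw
        by_contra hcon
        simp only [Set.mem_union, not_or, Set.mem_preimage, Set.mem_ofPred_eq, not_le, Set.mem_prod,
          Set.mem_univ, true_and] at hcon
        obtain ⟨n0, n1, n2, n3, -⟩ := hcon
        exact n0 ⟨hw, (abs_lt.1 n1).1.le, n2.le, n3.le⟩)
    have m1 := stdPi_prod_real_eq {w | diagQuad l a w ≤ 0}
      (measurableSet_le (measurable_diagQuad l a) measurable_const)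
    have m2 := stdPi_prod_real_eq {w | K ≤ |diagQuad l a w|}
      (measurableSet_le measurable_const (measurable_diagQuad l a).abs)
    have m3 := stdPi_prod_real_eq {w : Fin n → ℝ | K ≤ |w j|}
      (measurableSet_le measurable_const (measurable_pi_apply j).abs)
    have b2 := diagQuad_chebyshev l a K hK
    rw [hvar] at b2
    rw [m1, m2, m3, measureReal_prod_prod] at hsub
    simp only [probReal_univ, one_mul, measureReal_empty] at hsub
    linarith
  have hSδ : S * δ = 3 * K + A + 1 := by rw [hS]; field_simp
  have hSpos : 0 < S := by rw [hS]; positivity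
  have hS1 : 1 ≤ S := by nlinarith
  have hM : 0 < 2 * K + 1 + 2 * S := by positivity
  have hslope : ∀ w : (Fin n → ℝ) × (Fin n → ℝ),
      ∑ i, (l i * (w.1 i + w.2 i) + a i / √2) * u i = τ * (2 * l j * normSum w j + a j) := by
    intro w
    rw [Finset.sum_eq_single j (fun i _ hij => by simp [hu, hij]) (by simp)]
    simp only [hu, Pi.single_eq_same, normSum]
    field_simp
    linear_combination (τ * (l j * (w.1 j + w.2 j))) * h2'
  have hcurv : ∑ i, l i * u i ^ 2 = 2 * l j := by
    rw [Finset.sum_eq_single j (fun i _ hij => by simp [hu, hij]) (by simp)]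
    simp only [hu, Pi.single_eq_same, mul_pow, h2, hτ2]
    ring
  have hsweep := sweep_le μ (fun _ => u) measurable_const h hhm E hEm S (2 * K + 1 + 2 * S) (2 * K)
    2 x ε hSpos hM (by positivity) hε0
    (fun w hw s hs t ht => by
      simp only [hh, diagQuad_normSum_shift, hslope, hcurv]
      refine abs_quadratic_sub_le _ _ _ S _ s t hs ht ?_
      have e1 : |τ * (2 * l j * normSum w j + a j)| ≤ 2 * K + 1 := by
        rw [abs_mul, hτ, one_mul]
        refine (abs_add_le _ _).trans (add_le_add ?_ haj)
        rw [abs_mul, abs_of_pos (by linarith : 0 < 2 * l j)]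
        have := hw.2.2.1
        nlinarith [abs_nonneg (normSum w j)]
      have e2 : S * |2 * l j| ≤ 2 * S := by
        rw [abs_of_pos (by linarith : 0 < 2 * l j)]
        nlinarith
      linarith)
    (fun w hw => hw.1.trans hx0)
    -- Curvature gains at least `S²δ = S(3K + A + 1)` and the initial slope loses at most `2KS`.
    -- With `S ≥ 1` the net rise is at least `K + A + 1`.
    (fun w hw => by
      simp only [hh, diagQuad_normSum_shift, hslope, hcurv]
      have e0 : -K ≤ diagQuad l a (normSum (w.1, w.2)) := hw.2.1
      have e1 : -(2 * K) ≤ τ * (2 * l j * normSum w j + a j) := by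
        have : |τ * (2 * l j * normSum w j)| ≤ 2 * K := by
          rw [abs_mul, hτ, one_mul, abs_mul, abs_of_pos (by linarith : 0 < 2 * l j)]
          have := hw.2.2.1
          nlinarith [abs_nonneg (normSum w j)]
        have := (abs_le.1 this).1
        linarith
      have e2 := mul_le_mul_of_nonneg_left e1 hSpos.le
      have e3 : S ^ 2 / 2 * (2 * δ) ≤ S ^ 2 / 2 * (2 * l j) :=
        mul_le_mul_of_nonneg_left (by linarith) (by positivity)
      have e4 : S ^ 2 / 2 * (2 * δ) = S * (3 * K + A + 1) := by rw [← hSδ]; ring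
      have e5 : K + A + 1 ≤ S * (K + A + 1) := le_mul_of_one_le_left (by positivity) hS1
      linarith)
    (fun w hw => by
      rw [Finset.sum_eq_single j (fun i _ hij => by simp [hu, hij]) (by simp)]
      simp only [hu, Pi.single_eq_same]
      refine (le_abs_self _).trans ?_
      rw [abs_mul, abs_mul, hτ, mul_one, abs_of_pos h20]
      exact mul_le_mul h22 hw.2.2.2 (abs_nonneg _) (by norm_num))
    (fun w hw => by
      rw [Finset.sum_eq_single j (fun i _ hij => by simp [hu, hij]) (by simp)]
      simp only [hu, Pi.single_eq_same, mul_pow, h2, hτ2]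
      norm_num)
  have hfin := stdPi_prod_real_eq {w | diagQuad l a w ∈ Set.Icc x (x + ε)}
    (measurable_diagQuad l a measurableSet_Icc)
  rw [← hfin]
  refine le_trans ?_ hsweep
  gcongr

theorem diagQuad_le_smallBall (A : ℝ) (hA : 0 ≤ A) : ∃ c : ℝ, 0 < c ∧
    ∀ (n : ℕ) (l a : Fin n → ℝ), 2 * ∑ i, l i ^ 2 + ∑ i, a i ^ 2 = 1 →
      (∃ j, ∀ i, |l i| ≤ l j) → ∀ x ε : ℝ, 0 ≤ x → x ≤ A → 0 ≤ ε → ε ≤ 1 →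
        c * ε ≤ (stdPi n).real {w | diagQuad l a w ∈ Set.Icc x (x + ε)} := by
  obtain ⟨c₀, hc₀, hc₁, hprob⟩ : ∃ c₀ : ℝ, 0 < c₀ ∧ c₀ ≤ 1 ∧ ∀ (n : ℕ) (l a : Fin n → ℝ),
      2 * ∑ i, l i ^ 2 + ∑ i, a i ^ 2 = 1 → c₀ ≤ (stdPi n).real {w | diagQuad l a w ≤ 0} :=
    ⟨1 / (10 * 393216 ^ 2), by norm_num, by norm_num, fun n l a => diagQuad_le_prob_nonpos l a⟩
  set K := 8 / c₀ with hKdef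
  have hK : 0 < K := by positivity
  have hKc : 1 / K ^ 2 ≤ c₀ / 8 := by
    rw [hKdef, div_pow, one_div_div]
    nlinarith
  set S₁ := 16 * (A + K + 1) with hS₁
  have hS₁pos : 0 < S₁ := by positivity
  -- The threshold is fixed by the small-eigenvalue case; the sweep length `S₂` of the other case
  -- then depends on it.
  set δ := min (1 / (8 * S₁)) (c₀ / 768) with hδ
  have hδ0 : 0 < δ := lt_min (by positivity) (by positivity)
  have hδc : δ ≤ c₀ / 768 := min_le_right _ _
  have hSδ : S₁ * δ ≤ 1 / 8 := by
    calc S₁ * δ ≤ S₁ * (1 / (8 * S₁)) := by gcongr; exact min_le_left _ _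
      _ = 1 / 8 := by field_simp
  set S₂ := (3 * K + A + 1) / δ with hS₂
  have hS₂pos : 0 < S₂ := by positivity
  set c₁ := Real.exp (-(S₁ * K) - S₁ ^ 2 * 1 / 2) * (1 / (S₁ * 2)) * (c₀ / 2) with hc₁def
  set c₂ := Real.exp (-(S₂ * (2 * K)) - S₂ ^ 2 * 2 / 2) * (1 / (S₂ * (2 * K + 1 + 2 * S₂))) *
    (c₀ / 2) with hc₂def
  refine ⟨min c₁ c₂, lt_min (by positivity) (by positivity), ?_⟩
  rintro n l a hvar ⟨j, hj⟩ x ε hx0 hxA hε0 hε1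
  rcases le_total (l j) δ with h | h
  · refine (mul_le_mul_of_nonneg_right (min_le_left c₁ c₂) hε0).trans ?_
    refine le_trans (le_of_eq ?_) (diagQuad_le_smallBall_of_small l a hvar c₀ A K S₁ δ hc₀
      (hprob n l a hvar) hA hK hKc hS₁ hSδ (by nlinarith) (fun i => (hj i).trans h) x ε hx0 hxA
      hε0 hε1)
    rw [hc₁def]; ring
  · refine (mul_le_mul_of_nonneg_right (min_le_right c₁ c₂) hε0).trans ?_
    refine le_trans (le_of_eq ?_) (diagQuad_le_smallBall_of_large l a hvar c₀ A K S₂ δ hc₀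
      (hprob n l a hvar) hA hK hKc hS₂ hδ0 (by linarith) j h x ε hx0 hxA hε0 hε1)
    rw [hc₂def]; ring

end LowerBound

/-! ### Reduction to unit variance. -/

section Scaling

variable {n : ℕ}

lemma diagQuad_div (l a : Fin n → ℝ) (σ : ℝ) (w : Fin n → ℝ) :
    diagQuad (fun i => l i / σ) (fun i => a i / σ) w = diagQuad l a w / σ := by
  simp only [diagQuad, Finset.sum_div]
  exact Finset.sum_congr rfl fun i _ => by ring

lemma variance_div (l a : Fin n → ℝ) (σ : ℝ) (hσ : 0 < σ)
    (hvar : 2 * ∑ i, l i ^ 2 + ∑ i, a i ^ 2 = σ ^ 2) :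
    2 * ∑ i, (l i / σ) ^ 2 + ∑ i, (a i / σ) ^ 2 = 1 := by
  simp only [div_pow, ← Finset.sum_div]
  rw [mul_div_assoc', ← add_div, hvar, div_self (by positivity)]

lemma setOf_diagQuad_div_mem (l a : Fin n → ℝ) (σ x ε : ℝ) (hσ : 0 < σ) :
    {w | diagQuad (fun i => l i / σ) (fun i => a i / σ) w ∈ Set.Icc (x / σ) (x / σ + ε / σ)} =
      {w | diagQuad l a w ∈ Set.Icc x (x + ε)} := by
  ext w
  simp only [Set.mem_ofPred_eq, Set.mem_Icc, diagQuad_div, ← add_div]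
  rw [div_le_div_iff_of_pos_right hσ, div_le_div_iff_of_pos_right hσ]

end Scaling

/-! ### Spectral decomposition and rotation invariance. -/

section Diagonalization

variable {n : ℕ} {F : Matrix (Fin n) (Fin n) ℝ}

lemma frobenius_norm_sq_eq_trace (A : Matrix (Fin n) (Fin n) ℝ) :
    ‖A‖ ^ 2 = (A * Aᵀ).trace := by
  rw [Matrix.frobenius_norm_def, ← Real.sqrt_eq_rpow, Real.sq_sqrt (by positivity)]
  simp only [Matrix.trace, Matrix.diag_apply, Matrix.mul_apply, Matrix.transpose_apply]
  refine Finset.sum_congr rfl fun i _ => Finset.sum_congr rfl fun j _ => ?_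
  rw [Real.rpow_two, Real.norm_eq_abs, sq_abs, pow_two]

/-- The matrix with the eigenvectors of `F` and prescribed eigenvalues `d`. -/
noncomputable def conjDiagonal (hF : F.IsHermitian) (d : Fin n → ℝ) : Matrix (Fin n) (Fin n) ℝ :=
  (hF.eigenvectorUnitary : Matrix (Fin n) (Fin n) ℝ) * Matrix.diagonal d *
    (hF.eigenvectorUnitary : Matrix (Fin n) (Fin n) ℝ)ᵀ

lemma conjDiagonal_eigenvalues (hF : F.IsHermitian) : conjDiagonal hF hF.eigenvalues = F := by
  conv_rhs => rw [hF.spectral_theorem]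
  rw [Unitary.conjStarAlgAut_apply]
  rfl

lemma transpose_mul_eigenvectorUnitary (hF : F.IsHermitian) :
    (hF.eigenvectorUnitary : Matrix (Fin n) (Fin n) ℝ)ᵀ *
      (hF.eigenvectorUnitary : Matrix (Fin n) (Fin n) ℝ) = 1 :=
  Unitary.coe_star_mul_self hF.eigenvectorUnitary

lemma eigenvectorUnitary_mul_transpose (hF : F.IsHermitian) :
    (hF.eigenvectorUnitary : Matrix (Fin n) (Fin n) ℝ) *
      (hF.eigenvectorUnitary : Matrix (Fin n) (Fin n) ℝ)ᵀ = 1 :=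
  Unitary.coe_mul_star_self hF.eigenvectorUnitary

lemma norm_sq_conjDiagonal (hF : F.IsHermitian) (d : Fin n → ℝ) :
    ‖conjDiagonal hF d‖ ^ 2 = ∑ i, d i ^ 2 := by
  rw [frobenius_norm_sq_eq_trace, conjDiagonal]
  set U := (hF.eigenvectorUnitary : Matrix (Fin n) (Fin n) ℝ) with hU
  have h1 : U * Matrix.diagonal d * Uᵀ * (U * Matrix.diagonal d * Uᵀ)ᵀ =
      U * (Matrix.diagonal d * (Uᵀ * U) * Matrix.diagonal d * Uᵀ) := by
    simp only [Matrix.transpose_mul, Matrix.transpose_transpose, Matrix.diagonal_transpose,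
      Matrix.mul_assoc]
  rw [h1, transpose_mul_eigenvectorUnitary, Matrix.trace_mul_comm, Matrix.mul_assoc,
    transpose_mul_eigenvectorUnitary, Matrix.mul_one, Matrix.mul_one, Matrix.diagonal_mul_diagonal,
    Matrix.trace_diagonal]
  simp only [pow_two]

lemma norm_sq_eq_sum_eigenvalues (hF : F.IsHermitian) : ‖F‖ ^ 2 = ∑ i, hF.eigenvalues i ^ 2 := by
  rw [← norm_sq_conjDiagonal hF, conjDiagonal_eigenvalues]

lemma conjDiagonal_sub (hF : F.IsHermitian) (d e : Fin n → ℝ) :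
    conjDiagonal hF d - conjDiagonal hF e = conjDiagonal hF (d - e) := by
  simp only [conjDiagonal]
  rw [← Matrix.sub_mul, ← Matrix.mul_sub, Matrix.diagonal_sub]
  rfl

lemma rank_conjDiagonal_le (hF : F.IsHermitian) (d : Fin n → ℝ) (T : Finset (Fin n))
    (hd : ∀ i, i ∉ T → d i = 0) : (conjDiagonal hF d).rank ≤ T.card := by
  refine (Matrix.rank_mul_le_left _ _).trans ((Matrix.rank_mul_le_right _ _).trans ?_)
  rw [Matrix.rank_diagonal, Fintype.card_subtype]
  refine Finset.card_le_card fun i hi => ?_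
  by_contra hcon
  simp [hd i hcon] at hi

/-- Keeping only the eigenvalues in `T` gives a competitor of rank at most 3, whose squared
Frobenius error is the remaining sum. -/
lemma sum_compl_eigenvalues_of_low_rank (hF : F.IsHermitian) (hF0 : F ≠ 0) (η : ℝ)
    (h : ∀ G : Matrix (Fin n) (Fin n) ℝ, G.rank ≤ 3 → η ≤ ‖F - G‖ ^ 2 / ‖F‖ ^ 2)
    (T : Finset (Fin n)) (hT : T.card ≤ 3) :
    η * ∑ i, hF.eigenvalues i ^ 2 ≤ ∑ i ∈ Tᶜ, hF.eigenvalues i ^ 2 := by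
  classical
  set d : Fin n → ℝ := fun i => if i ∈ T then hF.eigenvalues i else 0 with hd
  have h1 := h (conjDiagonal hF d)
    ((rank_conjDiagonal_le hF d T fun i hi => by simp [hd, hi]).trans hT)
  rw [le_div_iff₀ (by have := norm_pos_iff.2 hF0; positivity), norm_sq_eq_sum_eigenvalues hF] at h1
  have h2 : F - conjDiagonal hF d = conjDiagonal hF (hF.eigenvalues - d) := by
    rw [← conjDiagonal_sub, conjDiagonal_eigenvalues]
  rw [h2, norm_sq_conjDiagonal] at h1
  refine h1.trans_eq ?_
  rw [← Finset.sum_subset (Finset.subset_univ Tᶜ)]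
  · exact Finset.sum_congr rfl fun i hi => by simp [hd, Finset.mem_compl.1 hi]
  · intro i _ hi
    simp [hd, Finset.notMem_compl.1 hi]

/-- In eigenvector coordinates, centring each square moves the trace into the constant term, which
becomes the mean. -/
lemma quadPoly_eq_diagQuad (hF : F.IsHermitian) (v : Fin n → ℝ) (c : ℝ) (z : Fin n → ℝ) :
    quadPoly F v c z =
      diagQuad hF.eigenvalues ((hF.eigenvectorUnitary : Matrix (Fin n) (Fin n) ℝ)ᵀ *ᵥ v)
        ((hF.eigenvectorUnitary : Matrix (Fin n) (Fin n) ℝ)ᵀ *ᵥ z) +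
        (∑ i, hF.eigenvalues i + c) := by
  set U := (hF.eigenvectorUnitary : Matrix (Fin n) (Fin n) ℝ) with hU
  have h1 : z ⬝ᵥ (F *ᵥ z) = ∑ i, hF.eigenvalues i * (Uᵀ *ᵥ z) i ^ 2 := by
    conv_lhs => rw [← conjDiagonal_eigenvalues hF, conjDiagonal, ← hU]
    rw [← Matrix.mulVec_mulVec, ← Matrix.mulVec_mulVec, Matrix.dotProduct_mulVec,
      ← Matrix.mulVec_transpose]
    simp only [dotProduct, Matrix.mulVec_diagonal]
    exact Finset.sum_congr rfl fun i _ => by ring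
  have h2 : v ⬝ᵥ z = ∑ i, (Uᵀ *ᵥ v) i * (Uᵀ *ᵥ z) i := by
    change _ = (Uᵀ *ᵥ v) ⬝ᵥ (Uᵀ *ᵥ z)
    rw [Matrix.dotProduct_mulVec, Matrix.vecMul_transpose, Matrix.mulVec_mulVec,
      eigenvectorUnitary_mul_transpose, Matrix.one_mulVec]
  rw [quadPoly, h1, h2, diagQuad]
  simp only [mul_sub, mul_one, Finset.sum_add_distrib, Finset.sum_sub_distrib]
  ring

lemma stdPi_map_eigenvectorUnitary (hF : F.IsHermitian) :
    (stdPi n).map (fun z => (hF.eigenvectorUnitary : Matrix (Fin n) (Fin n) ℝ)ᵀ *ᵥ z) =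
      stdPi n := by
  have h1 : (fun z : Fin n → ℝ => (hF.eigenvectorUnitary : Matrix (Fin n) (Fin n) ℝ)ᵀ *ᵥ z) =
      fun z => WithLp.ofLp (hF.eigenvectorBasis.repr (WithLp.toLp 2 z)) := by
    ext z i
    rw [hF.eigenvectorBasis.repr_apply_apply]
    simp [Matrix.mulVec, dotProduct, PiLp.inner_apply, mul_comm]
  have h2 := stdGaussian_map hF.eigenvectorBasis.repr
  rw [← map_pi_eq_stdGaussian, Measure.map_map (by fun_prop) (by fun_prop)] at h2
  have h3 := congrArg (Measure.map WithLp.ofLp) h2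
  rw [Measure.map_map (by fun_prop) (by fun_prop), Measure.map_map (by fun_prop) (by fun_prop)] at h3
  rw [h1]
  refine Eq.trans h3 ?_
  exact Measure.map_id

end Diagonalization

/-! ### Transfer to an arbitrary probability space. -/

section Law

variable {Ω : Type*} [MeasurableSpace Ω] {P : Measure Ω} [IsProbabilityMeasure P] {n : ℕ}

lemma IsStdGaussianVector.hasLaw_stdPi {Z : Ω → Fin n → ℝ} (hZ : IsStdGaussianVector P Z) :
    HasLaw Z (stdPi n) P := by
  have hm : ∀ i, AEMeasurable (fun ω => Z ω i) P := fun i => (hZ.hasLaw i).aemeasurable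
  refine ⟨aemeasurable_pi_lambda _ hm, ?_⟩
  have h := (iIndepFun_iff_map_fun_eq_pi_map hm).1 hZ.indep
  simp_rw [(hZ.hasLaw _).map_eq] at h
  exact h

/-- The centred quadratic polynomial has the law of its diagonalization. -/
lemma quadPoly_law {Z : Ω → Fin n → ℝ} (hZ : IsStdGaussianVector P Z)
    {F : Matrix (Fin n) (Fin n) ℝ} (hF : F.IsHermitian) (v : Fin n → ℝ) (c : ℝ)
    (hne : ∃ z w, quadPoly F v c z ≠ quadPoly F v c w)
    (f : Ω → ℝ) (hf : f = fun ω => quadPoly F v c (Z ω)) :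
    ∃ a : Fin n → ℝ, 0 < stdDev P f ∧
      2 * ∑ i, hF.eigenvalues i ^ 2 + ∑ i, a i ^ 2 = stdDev P f ^ 2 ∧
      ∀ x ε : ℝ, P.real {ω | f ω - ∫ ω', f ω' ∂P ∈ Set.Icc x (x + ε)} =
        (stdPi n).real {w | diagQuad hF.eigenvalues a w ∈ Set.Icc x (x + ε)} := by
  set U := (hF.eigenvectorUnitary : Matrix (Fin n) (Fin n) ℝ) with hU
  set l := hF.eigenvalues with hl
  set a := Uᵀ *ᵥ v with ha
  set W : Ω → Fin n → ℝ := fun ω => Uᵀ *ᵥ Z ω with hW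
  have hUm : Measurable fun z : Fin n → ℝ => Uᵀ *ᵥ z := by
    refine measurable_pi_lambda _ fun i => ?_
    simp only [Matrix.mulVec, dotProduct]
    fun_prop
  have hWm : AEMeasurable W P := hUm.comp_aemeasurable hZ.hasLaw_stdPi.aemeasurable
  have hWlaw : P.map W = stdPi n := by
    rw [← stdPi_map_eigenvectorUnitary hF, ← hZ.hasLaw_stdPi.map_eq,
      AEMeasurable.map_map_of_aemeasurable hUm.aemeasurable hZ.hasLaw_stdPi.aemeasurable]
    rfl
  have hq := quadPoly_eq_diagQuad hF v c
  have hf' : f = fun ω => diagQuad l a (W ω) + (∑ i, l i + c) := by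
    rw [hf]; ext ω; exact hq (Z ω)
  have hdm := measurable_diagQuad l a
  have hmean0 : ∫ ω, diagQuad l a (W ω) ∂P = 0 := by
    rw [← integral_map hWm hdm.aestronglyMeasurable, hWlaw, integral_diagQuad]
  have hint : Integrable (fun ω => diagQuad l a (W ω)) P := by
    have : Integrable (diagQuad l a) (P.map W) := by
      rw [hWlaw]; exact (memLp_diagQuad l a).integrable one_le_two
    exact this.comp_aemeasurable hWm
  have hmean : ∫ ω, f ω ∂P = ∑ i, l i + c := by
    rw [hf', integral_add hint (integrable_const _), hmean0]
    simp
  have hvar : variance f P = 2 * ∑ i, l i ^ 2 + ∑ i, a i ^ 2 := by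
    rw [← variance_diagQuad, ← hWlaw, variance_map hdm.aemeasurable hWm, hf']
    exact variance_add_const (hdm.comp_aemeasurable hWm).aestronglyMeasurable _
  have hL : 0 ≤ ∑ i, l i ^ 2 := Finset.sum_nonneg fun i _ => sq_nonneg _
  have hA : 0 ≤ ∑ i, a i ^ 2 := Finset.sum_nonneg fun i _ => sq_nonneg _
  refine ⟨a, ?_, ?_, fun x ε => ?_⟩
  -- Zero variance would force every `l i` and `a i` to vanish, making the polynomial constant.
  · rw [stdDev, Real.sqrt_pos, hvar]
    by_contra hcon
    push Not at hcon
    have hL0 : ∑ i, l i ^ 2 = 0 := by linarith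
    have hA0 : ∑ i, a i ^ 2 = 0 := by linarith
    rw [Finset.sum_eq_zero_iff_of_nonneg fun i _ => sq_nonneg _] at hL0 hA0
    obtain ⟨z, w, hzw⟩ := hne
    refine hzw ?_
    have h0 : ∀ y, diagQuad l a y = 0 := fun y => Finset.sum_eq_zero fun i hi => by
      rw [pow_eq_zero_iff two_ne_zero |>.1 (hL0 i hi), pow_eq_zero_iff two_ne_zero |>.1 (hA0 i hi)]
      ring
    rw [hq z, hq w, h0, h0]
  · rw [stdDev, Real.sq_sqrt (variance_nonneg _ _), hvar]
  · have hset : {ω | f ω - ∫ ω', f ω' ∂P ∈ Set.Icc x (x + ε)} =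
        W ⁻¹' {w | diagQuad l a w ∈ Set.Icc x (x + ε)} := by
      ext ω
      simp only [hmean, congrFun hf' ω, add_sub_cancel_right, Set.mem_ofPred_eq, Set.mem_preimage]
    have hms : MeasurableSet {w | diagQuad l a w ∈ Set.Icc x (x + ε)} := hdm measurableSet_Icc
    rw [hset, ← hWlaw, map_measureReal_apply_of_aemeasurable hWm hms]

end Law

theorem mainTheorem7 :
    -- Part (1); the constant `c` in the exponent is absolute, `C` depends only on `η`.
    (∃ c : ℝ, 0 < c ∧ ∀ η : ℝ, 0 < η → ∃ C : ℝ, 0 < C ∧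
      ∀ (n : ℕ) (F : Matrix (Fin n) (Fin n) ℝ) (v : Fin n → ℝ) (f₀ : ℝ),
        F.IsSymm → (∃ z w, quadPoly F v f₀ z ≠ quadPoly F v f₀ w) →
        F ≠ 0 →
        (∀ G : Matrix (Fin n) (Fin n) ℝ, G.rank ≤ 3 → η ≤ ‖F - G‖ ^ 2 / ‖F‖ ^ 2) →
      ∀ (Ω : Type*) [MeasurableSpace Ω] (P : Measure Ω) [IsProbabilityMeasure P]
        (Z : Ω → Fin n → ℝ), IsStdGaussianVector P Z →
      ∀ (f : Ω → ℝ), (f = fun ω => quadPoly F v f₀ (Z ω)) →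
      ∀ x ε : ℝ, 0 ≤ ε → ε ≤ stdDev P f →
        P.real {ω | f ω - ∫ ω', f ω' ∂P ∈ Set.Icc x (x + ε)} ≤
          C * (ε / stdDev P f) * Real.exp (-(c * (|x| / stdDev P f)))) ∧
    -- Part (2); the constant `c` depends only on `A`.
    (∀ A : ℝ, 0 < A → ∃ c : ℝ, 0 < c ∧
      ∀ (n : ℕ) (F : Matrix (Fin n) (Fin n) ℝ) (v : Fin n → ℝ) (f₀ : ℝ)
        (hF : F.IsSymm), (∃ z w, quadPoly F v f₀ z ≠ quadPoly F v f₀ w) →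
        (∃ i₁ : Fin n, ∀ i : Fin n, |(Matrix.isHermitian_iff_isSymm.mpr hF).eigenvalues i| ≤
          (Matrix.isHermitian_iff_isSymm.mpr hF).eigenvalues i₁) →
      ∀ (Ω : Type*) [MeasurableSpace Ω] (P : Measure Ω) [IsProbabilityMeasure P]
        (Z : Ω → Fin n → ℝ), IsStdGaussianVector P Z →
      ∀ (f : Ω → ℝ), (f = fun ω => quadPoly F v f₀ (Z ω)) →
      ∀ ε : ℝ, 0 ≤ ε → ε ≤ stdDev P f →
      ∀ x : ℝ, 0 ≤ x → x ≤ A * stdDev P f →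
        c * (ε / stdDev P f) ≤
          P.real {ω | f ω - ∫ ω', f ω' ∂P ∈ Set.Icc x (x + ε)}) := by
  refine ⟨⟨1 / 8, by norm_num, fun η hη => ?_⟩, fun A hA => ?_⟩
  · obtain ⟨C, hC, h⟩ := diagQuad_smallBall_le η hη
    refine ⟨C, hC, fun n F v f₀ hF hne hF0 hrank Ω _ P _ Z hZ f hf x ε hε0 hε1 => ?_⟩
    have hH := Matrix.isHermitian_iff_isSymm.mpr hF
    obtain ⟨a, hσ, hvar, hlaw⟩ := quadPoly_law hZ hH v f₀ hne f hf
    have hlow := sum_compl_eigenvalues_of_low_rank hH hF0 η hrank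
    rw [hlaw, ← setOf_diagQuad_div_mem _ _ _ x ε hσ]
    refine (h n _ _ (variance_div _ _ _ hσ hvar) (fun T hT => ?_) (x / stdDev P f)
      (ε / stdDev P f) (by positivity) ((div_le_one hσ).2 hε1)).trans_eq ?_
    · simp only [div_pow, ← Finset.sum_div]
      rw [mul_div_assoc']
      exact div_le_div_of_nonneg_right (hlow T hT) (sq_nonneg _)
    · rw [abs_div, abs_of_pos hσ]
  · obtain ⟨c, hc, h⟩ := diagQuad_le_smallBall A hA.le
    refine ⟨c, hc, fun n F v f₀ hF hne hmax Ω _ P _ Z hZ f hf ε hε0 hε1 x hx0 hxA => ?_⟩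
    obtain ⟨a, hσ, hvar, hlaw⟩ := quadPoly_law hZ (Matrix.isHermitian_iff_isSymm.mpr hF) v f₀ hne f hf
    rw [hlaw, ← setOf_diagQuad_div_mem _ _ _ x ε hσ]
    refine h n _ _ (variance_div _ _ _ hσ hvar) ?_ _ _ (by positivity) ((div_le_iff₀ hσ).2 hxA)
      (by positivity) ((div_le_one hσ).2 hε1)
    obtain ⟨j, hj⟩ := hmax
    refine ⟨j, fun i => ?_⟩
    rw [abs_div, abs_of_pos hσ]
    exact div_le_div_of_nonneg_right (hj i) hσ.le
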